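/- Let $C_{237}$ be the curve over $\mathbb{Q}$ given by $$y^2 = f(x) := x^8 + (4-4\cdot 237^4)x^6 + (8\cdot 237^4+6)x^4 + (4-4\cdot 237^4)x^2 + 1 .$$ The polynomial $f$ is monic and separable of degree $8$, so that $C_{237}$ is a hyperelliptic curve of genus $3$. Its smooth projective model is $$y^2 = x^8 + (4-4\cdot 237^4)x^6z^2 + (8\cdot 237^4+6)x^4z^4 + (4-4\cdot 237^4)x^2z^6 + z^8$$ in the weighted projective plane $\mathbb{P}(1,4,1)$, where $(x:y:z) = (tx:t^4y:tz)$ for $t \neq 0$. Then $$C_{237}(\mathbb{Q}) = \{(\pm 1:\pm 4:1),\ (0:\pm 1:1),\ (1:\pm 1:0)\},$$ where all choices of signs are allowed independently; these are exactly eight rational points. -/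

import Mathlib

open Polynomial

/-- Nonzero coordinate triples `(x, y, z)` of rational numbers. -/
abbrev NonzeroTriple : Type := {v : ℚ × ℚ × ℚ // v ≠ (0, 0, 0)}

/-- Two nonzero triples are equivalent when they differ by the action of some `t ∈ ℚˣ` with weights
`(1, g + 1, 1)`, namely `t • (x, y, z) = (t x, t ^ (g + 1) y, t z)`. -/
def weightedSetoid (g : ℕ) : Setoid NonzeroTriple where
  r v w := ∃ t : ℚ, t ≠ 0 ∧
    w.1.1 = t * v.1.1 ∧ w.1.2.1 = t ^ (g + 1) * v.1.2.1 ∧ w.1.2.2 = t * v.1.2.2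
  iseqv :=
    { refl := fun _ => ⟨1, one_ne_zero, by simp, by simp, by simp⟩
      symm := by
        rintro v w ⟨t, ht, h1, h2, h3⟩
        refine ⟨t⁻¹, inv_ne_zero ht, ?_, ?_, ?_⟩
        · rw [h1, inv_mul_cancel_left₀ ht]
        · rw [h2, inv_pow, inv_mul_cancel_left₀ (pow_ne_zero _ ht)]
        · rw [h3, inv_mul_cancel_left₀ ht]
      trans := by
        rintro u v w ⟨t, ht, h1, h2, h3⟩ ⟨s, hs, k1, k2, k3⟩
        refine ⟨s * t, mul_ne_zero hs ht, ?_, ?_, ?_⟩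
        · rw [k1, h1, mul_assoc]
        · rw [k2, h2, mul_pow, mul_assoc]
        · rw [k3, h3, mul_assoc] }

/-- The rational points of the weighted projective plane `ℙ(1, g + 1, 1)`, which is the ambient space
of the projective model of a hyperelliptic curve of genus `g`. -/
def WeightedPlane (g : ℕ) : Type := Quotient (weightedSetoid g)

/-- The point `(x : y : z)` of `ℙ(1, g + 1, 1)`. -/
def WeightedPlane.mk (g : ℕ) (x y z : ℚ) (h : (x, y, z) ≠ (0, 0, 0)) : WeightedPlane g :=
  Quotient.mk (weightedSetoid g) ⟨(x, y, z), h⟩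

/-- `y² = f(x)` is a model of a hyperelliptic curve of genus `g` over `ℚ`: `g ≥ 2`, and `f` is monic
of degree `2g + 1` or `2g + 2` without multiple roots (so that the projective model is smooth). -/
structure IsHyperellipticModel (g : ℕ) (f : ℚ[X]) : Prop where
  two_le : 2 ≤ g
  monic : f.Monic
  degree : f.natDegree = 2 * g + 1 ∨ f.natDegree = 2 * g + 2
  separable : f.Separable

/-- The value at `(x, z)` of the form of degree `2g + 2` obtained by homogenizing `f`. -/
def homogenizedEval (g : ℕ) (f : ℚ[X]) (x z : ℚ) : ℚ :=
  ∑ i ∈ Finset.range (2 * g + 3), f.coeff i * x ^ i * z ^ (2 * g + 2 - i)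

/-- The set of rational points of the smooth projective model `y² = F(x, z)` in `ℙ(1, g + 1, 1)` of the
hyperelliptic curve `y² = f(x)` of genus `g`, where `F` is the form of degree `2g + 2` of `f`. -/
def hyperellipticPoints (g : ℕ) (f : ℚ[X]) : Set (WeightedPlane g) :=
  {P | ∃ (x y z : ℚ) (h : (x, y, z) ≠ (0, 0, 0)),
    P = WeightedPlane.mk g x y z h ∧ y ^ 2 = homogenizedEval g f x z}

/-- The equation does not depend on the chosen homogeneous coordinates. -/
theorem mk_mem_hyperellipticPoints (g : ℕ) (f : ℚ[X]) (x y z : ℚ) (h : (x, y, z) ≠ (0, 0, 0)) :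
    WeightedPlane.mk g x y z h ∈ hyperellipticPoints g f ↔ y ^ 2 = homogenizedEval g f x z := by
  constructor
  · rintro ⟨x', y', z', h', he, hy⟩
    obtain ⟨t, ht, h1, h2, h3⟩ := Quotient.exact he.symm
    simp only at h1 h2 h3
    rw [h1, h2, h3, mul_pow, hy]
    unfold homogenizedEval
    rw [Finset.mul_sum]
    refine Finset.sum_congr rfl fun i hi => ?_
    have hi' : i + (2 * g + 2 - i) = 2 * g + 2 := by
      have := Finset.mem_range.mp hi
      omega
    have ht' : (t ^ (g + 1)) ^ 2 = t ^ i * t ^ (2 * g + 2 - i) := by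
      rw [← pow_add, hi', ← pow_mul]
      congr 1
      ring
    rw [ht', mul_pow, mul_pow]
    ring
  · intro hy
    exact ⟨x, y, z, h, rfl, hy⟩

/-- The polynomial `x⁸ + (4 - 4a⁴) x⁶ + (8a⁴ + 6) x⁴ + (4 - 4a⁴) x² + 1` defining `C_a`. -/
noncomputable def curvePoly (a : ℤ) : ℚ[X] :=
  X ^ 8 + C (4 - 4 * (a : ℚ) ^ 4) * X ^ 6 + C (8 * (a : ℚ) ^ 4 + 6) * X ^ 4
    + C (4 - 4 * (a : ℚ) ^ 4) * X ^ 2 + 1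

/-! Put c = 237², W = x² + z² and S = 2xz(x² - z²). The form of the curve is W⁴ - c²S² = (W² +
cS)(W² - cS), so the claim amounts to S = 0 at every rational point. In coprime integers the two
factors are coprime up to a common factor 4, because the primes 3 and 79 of 237 are 3 mod 4 and
cannot divide W; hence both are squares (`exists_sq_factors`). Moreover W² ± 2S are squares
identically. With ξ = 2cS/W², both ξ and -ξ are therefore abscissae of points on E : y² = (x - c)(x²
- 4), and both points lie in the 2-descent class of P = `basePoint`.

It remains to see that ξ = 0 (`eq_zero_of_isOddAbscissa_neg`). Since ξ and -ξ have the same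
denominator w², it suffices that w determines a point of this class up to sign. This follows from
two facts: every point of the class is an odd multiple of P (`HasOddDenominator.exists_eq_smul`),
and the denominators of P, 3P, 5P, ... strictly increase (`exists_denominators_lt`).

Both facts rest on exact formulas for Q ± P. If Q ≠ ±P is in the class, the numerators at Q ± P have
product close to c²w⁴ (`OddCoordinates.neighbours`); conversely, a numerator in the trivial class is
at most 2ww', where w and w' belong to its two neighbours (`EvenCoordinates.neighbours`). Together
these force growth. For the descent, one of Q ± P has odd denominator and so equals 2R with R again
in the class of P (`EvenCoordinates.exists_half`). The numerator of 2R is at least about c²r⁸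
(`OddCoordinates.le_of_double`), which makes the denominator r of R smaller than w. -/

/-! ### The elliptic curve and its group law -/

/-- The elliptic curve `y² = (x - 237²) (x² - 4)`. -/
def pairCurve : WeierstrassCurve.Affine ℚ := ⟨0, -56169, 0, -4, 224676⟩

lemma pairCurve_nonsingular {x y : ℚ} (h : y ^ 2 = (x - 56169) * (x ^ 2 - 4)) :
    pairCurve.Nonsingular x y := by
  rw [← WeierstrassCurve.Affine.equation_iff_nonsingular_of_Δ_ne_zero,
    WeierstrassCurve.Affine.equation_iff]
  · simp only [pairCurve]
    linear_combination h
  · simp only [pairCurve, WeierstrassCurve.Δ, WeierstrassCurve.b₂, WeierstrassCurve.b₄,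
      WeierstrassCurve.b₆, WeierstrassCurve.b₈]
    norm_num

/-- The point of `pairCurve` with given affine coordinates. -/
def affinePoint (x y : ℚ) (h : y ^ 2 = (x - 56169) * (x ^ 2 - 4)) : pairCurve.Point :=
  .some x y (pairCurve_nonsingular h)

lemma neg_affinePoint {x y : ℚ} (h : y ^ 2 = (x - 56169) * (x ^ 2 - 4)) :
    -affinePoint x y h = affinePoint x (-y) (by rw [neg_sq, h]) := by
  unfold affinePoint
  rw [WeierstrassCurve.Affine.Point.neg_some]
  congr 1
  simp [WeierstrassCurve.Affine.negY, pairCurve]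

lemma affinePoint_congr {x y x' y' : ℚ} {h : y ^ 2 = (x - 56169) * (x ^ 2 - 4)}
    {h' : y' ^ 2 = (x' - 56169) * (x' ^ 2 - 4)} (hx : x = x') (hy : y = y') :
    affinePoint x y h = affinePoint x' y' h' := by
  subst hx hy; rfl

lemma affinePoint_eq_or_eq_neg {x y y' : ℚ} (h : y ^ 2 = (x - 56169) * (x ^ 2 - 4))
    (h' : y' ^ 2 = (x - 56169) * (x ^ 2 - 4)) :
    affinePoint x y h = affinePoint x y' h' ∨ affinePoint x y h = -affinePoint x y' h' := by
  rw [neg_affinePoint]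
  rcases sq_eq_sq_iff_eq_or_eq_neg.mp (h.trans h'.symm) with e | e
  · exact .inl (affinePoint_congr rfl e)
  · exact .inr (affinePoint_congr rfl e)

/-- The point `(0, 474)`, which generates the group of rational points modulo torsion. -/
def basePoint : pairCurve.Point := affinePoint 0 474 (by norm_num)

lemma affinePoint_add_of_ne {x₁ y₁ x₂ y₂ l : ℚ} (h₁ : y₁ ^ 2 = (x₁ - 56169) * (x₁ ^ 2 - 4))
    (h₂ : y₂ ^ 2 = (x₂ - 56169) * (x₂ ^ 2 - 4)) (hx : x₁ ≠ x₂) (hl : l * (x₁ - x₂) = y₁ - y₂) :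
    ∃ h, affinePoint x₁ y₁ h₁ + affinePoint x₂ y₂ h₂ =
      affinePoint (l ^ 2 + 56169 - x₁ - x₂) (-(l * (l ^ 2 + 56169 - x₁ - x₂ - x₁) + y₁)) h := by
  have hs : pairCurve.slope x₁ x₂ y₁ y₂ = l := by
    rw [WeierstrassCurve.Affine.slope_of_X_ne hx, div_eq_iff (sub_ne_zero.mpr hx), hl]
  have hX : pairCurve.addX x₁ x₂ l = l ^ 2 + 56169 - x₁ - x₂ := by
    simp [WeierstrassCurve.Affine.addX, pairCurve]
  have hY : pairCurve.addY x₁ x₂ y₁ l = -(l * (l ^ 2 + 56169 - x₁ - x₂ - x₁) + y₁) := by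
    simp [WeierstrassCurve.Affine.addY, WeierstrassCurve.Affine.negAddY,
      WeierstrassCurve.Affine.negY, WeierstrassCurve.Affine.addX, pairCurve]
  have h3 := WeierstrassCurve.Affine.equation_add (pairCurve_nonsingular h₁).1
    (pairCurve_nonsingular h₂).1 (fun h => hx h.1)
  rw [hs, hX, hY, WeierstrassCurve.Affine.equation_iff] at h3
  simp only [pairCurve] at h3
  refine ⟨by linear_combination h3, ?_⟩
  unfold affinePoint
  rw [WeierstrassCurve.Affine.Point.add_of_X_ne hx]
  simp only [hs, hX, hY]

lemma affinePoint_add_self {x y l : ℚ} (h : y ^ 2 = (x - 56169) * (x ^ 2 - 4))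
    (hy : y ≠ 0) (hl : l * (2 * y) = 3 * x ^ 2 - 112338 * x - 4) :
    ∃ h', affinePoint x y h + affinePoint x y h =
      affinePoint (l ^ 2 + 56169 - x - x) (-(l * (l ^ 2 + 56169 - x - x - x) + y)) h' := by
  have hne : y ≠ pairCurve.negY x y := by
    simp only [WeierstrassCurve.Affine.negY, pairCurve]
    intro h0
    exact hy (by linarith)
  have hs : pairCurve.slope x x y y = l := by
    rw [WeierstrassCurve.Affine.slope_of_Y_ne rfl hne]
    simp only [WeierstrassCurve.Affine.negY, pairCurve]
    rw [div_eq_iff (by intro h0; exact hy (by linarith))]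
    linear_combination -hl
  have hX : pairCurve.addX x x l = l ^ 2 + 56169 - x - x := by
    simp [WeierstrassCurve.Affine.addX, pairCurve]
  have hY : pairCurve.addY x x y l = -(l * (l ^ 2 + 56169 - x - x - x) + y) := by
    simp [WeierstrassCurve.Affine.addY, WeierstrassCurve.Affine.negAddY,
      WeierstrassCurve.Affine.negY, WeierstrassCurve.Affine.addX, pairCurve]
  have h3 := WeierstrassCurve.Affine.equation_add (pairCurve_nonsingular h).1
    (pairCurve_nonsingular h).1 (fun h => hne h.2)
  rw [hs, hX, hY, WeierstrassCurve.Affine.equation_iff] at h3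
  simp only [pairCurve] at h3
  refine ⟨by linear_combination h3, ?_⟩
  unfold affinePoint
  rw [WeierstrassCurve.Affine.Point.add_self_of_Y_ne hne]
  simp only [hs, hX, hY]

/-! ### Square classes and translation by the base point -/

/-- The abscissae of the points in the square class of `basePoint`. -/
def IsOddAbscissa (x : ℚ) : Prop :=
  ∃ α β γ : ℚ, 2 - x = 2 * α ^ 2 ∧ 2 + x = 2 * β ^ 2 ∧ 56169 - x = γ ^ 2

/-- The abscissae of the nonzero points in the trivial square class. -/
def IsEvenAbscissa (x : ℚ) : Prop :=
  ∃ α β γ : ℚ, x - 2 = α ^ 2 ∧ x + 2 = β ^ 2 ∧ x - 56169 = γ ^ 2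

lemma not_sq_of_not_isSquare {q r : ℚ} (h : ¬ IsSquare q) : r ^ 2 ≠ q := fun e =>
  h ⟨r, by rw [← e, sq]⟩

/-- The class contains no 2-torsion: x = ±2 would make 2 a square, and x = 56169 contradicts the
sign of 2 - x. -/
lemma IsOddAbscissa.ne {x : ℚ} (h : IsOddAbscissa x) : x ≠ 2 ∧ x ≠ -2 ∧ x ≠ 56169 := by
  obtain ⟨α, β, γ, hα, hβ, hγ⟩ := h
  have h2 : ¬ IsSquare (2 : ℚ) := by norm_num
  refine ⟨?_, ?_, ?_⟩ <;> rintro rfl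
  · exact not_sq_of_not_isSquare h2 (r := β) (by linarith)
  · exact not_sq_of_not_isSquare h2 (r := α) (by linarith)
  · nlinarith [sq_nonneg α]

lemma IsEvenAbscissa.ne {x : ℚ} (h : IsEvenAbscissa x) : x ≠ 56169 := by
  obtain ⟨α, β, γ, hα, hβ, hγ⟩ := h
  have h2 : ¬ IsSquare (56167 : ℚ) := by norm_num
  rintro rfl
  exact not_sq_of_not_isSquare h2 (r := α) (by linarith)

lemma IsEvenAbscissa.le {x : ℚ} (h : IsEvenAbscissa x) : 56169 ≤ x := by
  obtain ⟨α, β, γ, hα, hβ, hγ⟩ := h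
  nlinarith [sq_nonneg γ]

section secant

variable {x y l s : ℚ}

/-- For the line y = lT + s through (0, s), with s = ±474, this compares the coefficients of T in (T
- 56169)(T² - 4) - (lT + s)² = T(T - x)(T - u). -/
lemma secant_relation (hs : s ^ 2 = 224676) (h : y ^ 2 = (x - 56169) * (x ^ 2 - 4)) (hx : x ≠ 0)
    (hl : l * x = y - s) : l ^ 2 * x + 2 * s * l = x ^ 2 - 56169 * x - 4 := by
  have hy : y = l * x + s := by linarith
  subst hy
  apply mul_left_cancel₀ hx
  linear_combination h - hs

/-- Evaluating the factorization of the cubic along the secant at T = 2, -2 and 56169 expresses each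
difference of the third abscissa as a square over a known one; the witnesses are the resulting
roots. -/
lemma IsOddAbscissa.secant (ho : IsOddAbscissa x) (hs : s ^ 2 = 224676)
    (h : y ^ 2 = (x - 56169) * (x ^ 2 - 4)) (hx : x ≠ 0) (hl : l * x = y - s) :
    IsEvenAbscissa (l ^ 2 + 56169 - x) := by
  have hr := secant_relation hs h hx hl
  obtain ⟨h1, h2, h3⟩ := ho.ne
  obtain ⟨α, β, γ, hα, hβ, hγ⟩ := ho
  have hα0 : α ≠ 0 := by rintro rfl; exact h1 (by linarith)
  have hβ0 : β ≠ 0 := by rintro rfl; exact h2 (by linarith)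
  have hγ0 : γ ≠ 0 := by rintro rfl; exact h3 (by linarith)
  refine ⟨(l * 2 + s) / (2 * α), (l * (-2) + s) / (2 * β), (l * 56169 + s) / (237 * γ), ?_, ?_, ?_⟩
  · rw [div_pow, eq_div_iff (by positivity)]
    linear_combination (-2 * (l ^ 2 + 56169 - x - 2)) * hα - hs - 2 * hr
  · rw [div_pow, eq_div_iff (by positivity)]
    linear_combination (-2 * (l ^ 2 + 56169 - x + 2)) * hβ - hs + 2 * hr
  · rw [div_pow, eq_div_iff (by positivity)]
    linear_combination (-56169 * (l ^ 2 + 56169 - x - 56169)) * hγ - hs - 56169 * hr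

lemma IsEvenAbscissa.secant (ho : IsEvenAbscissa x) (hs : s ^ 2 = 224676)
    (h : y ^ 2 = (x - 56169) * (x ^ 2 - 4)) (hx : x ≠ 0) (hl : l * x = y - s) :
    IsOddAbscissa (l ^ 2 + 56169 - x) := by
  have hr := secant_relation hs h hx hl
  have h1 := ho.ne
  have h2 := ho.le
  obtain ⟨α, β, γ, hα, hβ, hγ⟩ := ho
  have hα0 : α ≠ 0 := by rintro rfl; linarith
  have hβ0 : β ≠ 0 := by rintro rfl; linarith
  have hγ0 : γ ≠ 0 := by rintro rfl; exact h1 (by linarith)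
  refine ⟨(l * 2 + s) / (2 * α), (l * (-2) + s) / (2 * β), (l * 56169 + s) / (237 * γ), ?_, ?_, ?_⟩
  · rw [div_pow, ← mul_div_assoc, eq_div_iff (by positivity)]
    linear_combination (4 * (l ^ 2 + 56169 - x - 2)) * hα - 2 * hs - 4 * hr
  · rw [div_pow, ← mul_div_assoc, eq_div_iff (by positivity)]
    linear_combination (-4 * (l ^ 2 + 56169 - x + 2)) * hβ - 2 * hs + 4 * hr
  · rw [div_pow, eq_div_iff (by positivity)]
    linear_combination (56169 * (l ^ 2 + 56169 - x - 56169)) * hγ - hs - 56169 * hr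

end secant

/-- The sum and the difference of an affine point and `basePoint`. -/
lemma affinePoint_add_sub_basePoint {x y : ℚ} (h : y ^ 2 = (x - 56169) * (x ^ 2 - 4))
    (hx : x ≠ 0) : ∃ (u v : ℚ) (u' v' : ℚ) (hu : u' ^ 2 = (u - 56169) * (u ^ 2 - 4))
      (hv : v' ^ 2 = (v - 56169) * (v ^ 2 - 4)),
      affinePoint x y h + basePoint = affinePoint u u' hu ∧
      affinePoint x y h - basePoint = affinePoint v v' hv ∧
      (u + v) * x ^ 2 = 8 * (112338 - x) ∧ u * v * x ^ 2 = 16 * (3154956562 - 56169 * x) ∧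
      (IsOddAbscissa x → IsEvenAbscissa u ∧ IsEvenAbscissa v) ∧
      (IsEvenAbscissa x → IsOddAbscissa u ∧ IsOddAbscissa v) := by
  -- The slopes l and m are those of the chords to `basePoint` and to its negative. The sum and
  -- product of the new abscissae are even in y, hence rational functions of x alone.
  have hl : (y - 474) / x * x = y - 474 := div_mul_cancel₀ _ hx
  have hm : (y + 474) / x * x = y - -474 := by rw [div_mul_cancel₀ _ hx]; ring
  set l := (y - 474) / x
  set m := (y + 474) / x
  have hrl := secant_relation (s := 474) (by norm_num) h hx hl
  have hrm := secant_relation (s := -474) (by norm_num) h hx hm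
  obtain ⟨h1, e1⟩ := affinePoint_add_of_ne (l := l) h (y₂ := 474) (x₂ := 0) (by norm_num) hx
    (by linarith)
  obtain ⟨h2, e2⟩ := affinePoint_add_of_ne (l := m) h (y₂ := -474) (x₂ := 0) (by norm_num) hx
    (by linarith)
  refine ⟨_, _, _, _, h1, h2, e1, ?_, ?_, ?_, ?_, ?_⟩
  · rw [sub_eq_add_neg, basePoint, neg_affinePoint, e2]
  · have a1 : l ^ 2 * x ^ 2 = (y - 474) ^ 2 := by rw [← hl]; ring
    have a2 : m ^ 2 * x ^ 2 = (y + 474) ^ 2 := by rw [← sub_neg_eq_add, ← hm]; ring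
    linear_combination a1 + a2 + 2 * h
  · have a1 : l ^ 2 * x ^ 2 = (y - 474) ^ 2 := by rw [← hl]; ring
    have a2 : m ^ 2 * x ^ 2 = (y + 474) ^ 2 := by rw [← sub_neg_eq_add, ← hm]; ring
    have hx2 : x ^ 2 ≠ 0 := pow_ne_zero _ hx
    apply mul_right_cancel₀ hx2
    have : (l ^ 2 * x ^ 2 + (56169 - x - 0) * x ^ 2) * (m ^ 2 * x ^ 2 + (56169 - x - 0) * x ^ 2)
        = 16 * (3154956562 - 56169 * x) * x ^ 2 := by
      rw [a1, a2]
      linear_combination (y ^ 2 + ((x - 56169) * (x ^ 2 - 4)) - 449352 + 2 * (56169 - x) * x ^ 2) * h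
    linear_combination this
  · intro ho
    constructor
    · rw [sub_zero]; exact ho.secant (s := 474) (by norm_num) h hx hl
    · rw [sub_zero]; exact ho.secant (s := -474) (by norm_num) h hx hm
  · intro ho
    constructor
    · rw [sub_zero]; exact ho.secant (s := 474) (by norm_num) h hx hl
    · rw [sub_zero]; exact ho.secant (s := -474) (by norm_num) h hx hm

/-! ### Primitive triples and coprime coordinates -/

/-- No prime divides all three integers. -/
def IsPrimitiveTriple (p q r : ℤ) : Prop := ∀ l : ℤ, Prime l → l ∣ p → l ∣ q → l ∣ r → False

lemma IsPrimitiveTriple.exists_combination {p q r : ℤ} (h : IsPrimitiveTriple p q r) :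
    ∃ a b d : ℤ, a * p + b * q + d * r = 1 := by
  have h1 : Int.gcd (Int.gcd p q) r = 1 := by
    by_contra hne
    obtain ⟨l, hl, hd⟩ := Nat.exists_prime_and_dvd hne
    have hd' : (l : ℤ) ∣ (Int.gcd (Int.gcd p q) r : ℤ) := Int.natCast_dvd_natCast.mpr hd
    have h2 := hd'.trans (Int.gcd_dvd_left _ _)
    exact h l (Nat.prime_iff_prime_int.mp hl) (h2.trans (Int.gcd_dvd_left _ _))
      (h2.trans (Int.gcd_dvd_right _ _)) (hd'.trans (Int.gcd_dvd_right _ _))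
  have h2 := Int.gcd_eq_gcd_ab (Int.gcd p q) r
  rw [h1] at h2
  nth_rewrite 1 [Int.gcd_eq_gcd_ab p q] at h2
  rw [Nat.cast_one] at h2
  exact ⟨p.gcdA q * (p.gcd q : ℤ).gcdA r, p.gcdB q * (p.gcd q : ℤ).gcdA r, (p.gcd q : ℤ).gcdB r, by
    linear_combination -h2⟩

lemma IsPrimitiveTriple.dvd {p q r p' q' r' : ℤ} (h : IsPrimitiveTriple p q r)
    (hq : p * q' = p' * q) (hr : p * r' = p' * r) : p ∣ p' := by
  obtain ⟨a, b, d, e⟩ := h.exists_combination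
  exact ⟨a * p' + b * q' + d * r', by linear_combination (-p') * e - b * hq - d * hr⟩

/-- This turns proportionality, which is all that the addition formulas give, into equality of
integers. -/
lemma IsPrimitiveTriple.eq {p q r p' q' r' : ℤ} (h : IsPrimitiveTriple p q r)
    (h' : IsPrimitiveTriple p' q' r') (hp : 0 < p) (hp' : 0 < p')
    (hq : p * q' = p' * q) (hr : p * r' = p' * r) : p = p' ∧ q = q' ∧ r = r' := by
  have e : p = p' := Int.dvd_antisymm hp.le hp'.le (h.dvd hq hr) (h'.dvd hq.symm hr.symm)
  subst e
  exact ⟨rfl, (mul_left_cancel₀ hp.ne' hq).symm, (mul_left_cancel₀ hp.ne' hr).symm⟩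

lemma IsCoprime.not_prime_dvd {a b l : ℤ} (h : IsCoprime a b) (hl : Prime l) (ha : l ∣ a)
    (hb : l ∣ b) : False := hl.not_isUnit (h.isUnit_of_dvd' ha hb)

/-- Gauss's lemma for the product (wT + x)(w'T + x') of primitive linear polynomials. -/
lemma isPrimitiveTriple_mul {x w x' w' : ℤ} (h : IsCoprime x w) (h' : IsCoprime x' w') :
    IsPrimitiveTriple (w * w') (x * w' + x' * w) (x * x') := by
  intro l hl h1 h2 h3
  rcases hl.dvd_or_dvd h1 with hw | hw
  · rcases hl.dvd_or_dvd ((Int.dvd_add_left (hw.mul_left x')).mp h2) with hx | hx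
    · exact h.not_prime_dvd hl hx hw
    · rcases hl.dvd_or_dvd h3 with hy | hy
      · exact h.not_prime_dvd hl hy hw
      · exact h'.not_prime_dvd hl hy hx
  · rcases hl.dvd_or_dvd ((Int.dvd_add_right (hw.mul_left x)).mp h2) with hx | hx
    · exact h'.not_prime_dvd hl hx hw
    · rcases hl.dvd_or_dvd h3 with hy | hy
      · exact h.not_prime_dvd hl hy hx
      · exact h'.not_prime_dvd hl hy hw

/-- A rational number whose square is an integer is an integer. -/
lemma exists_int_eq_of_sq_eq {q : ℚ} {n : ℤ} (h : q ^ 2 = n) : ∃ m : ℤ, q = m := by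
  have hi : IsIntegral ℤ q := ⟨X ^ 2 - C n, monic_X_pow_sub_C n two_ne_zero, by
    rw [eval₂_sub, eval₂_X_pow, eval₂_C, h]; simp⟩
  obtain ⟨m, hm⟩ := IsIntegrallyClosed.isIntegral_iff.mp hi
  exact ⟨m, by simpa using hm.symm⟩

/-- Coprime coordinates `x = X / w²` of an abscissa in the class of `basePoint`. -/
structure OddCoordinates (x : ℚ) (X w : ℤ) : Prop where
  pos : 0 < w
  eq : x * (w : ℚ) ^ 2 = X
  coprime : IsCoprime X w
  odd : Odd w
  dvd : 16 ∣ X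
  squares : ∃ α β γ : ℤ, 2 * w ^ 2 - X = 2 * α ^ 2 ∧ 2 * w ^ 2 + X = 2 * β ^ 2 ∧
    56169 * w ^ 2 - X = γ ^ 2 ∧ Odd α ∧ Odd β

/-- Coprime coordinates `x = M / K²` of an abscissa in the trivial class. -/
structure EvenCoordinates (x : ℚ) (M K : ℤ) : Prop where
  pos : 0 < K
  eq : x * (K : ℚ) ^ 2 = M
  coprime : IsCoprime M K
  squares : ∃ α β γ : ℤ, M - 2 * K ^ 2 = α ^ 2 ∧ M + 2 * K ^ 2 = β ^ 2 ∧
    M - 56169 * K ^ 2 = γ ^ 2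

lemma odd_and_odd_of_sq_add_sq_eq {a b w : ℤ} (h : a ^ 2 + b ^ 2 = 2 * w ^ 2)
    (hc : IsCoprime b w) : Odd a ∧ Odd b ∧ Odd w := by
  rcases Int.even_or_odd a with ha | ha
  · have hb : Even b := by
      have : Even (a ^ 2 + b ^ 2) := h ▸ even_two_mul _
      rw [Int.even_add, Int.even_pow, Int.even_pow] at this
      tauto
    exfalso
    obtain ⟨i, rfl⟩ := ha
    obtain ⟨j, rfl⟩ := hb
    have hw : Even (w ^ 2) := ⟨i ^ 2 + j ^ 2, by nlinarith⟩
    rw [Int.even_pow] at hw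
    exact hc.not_prime_dvd Int.prime_two ⟨j, by ring⟩ hw.1.two_dvd
  · have hb : Odd b := by
      have : Even (a ^ 2 + b ^ 2) := h ▸ even_two_mul _
      rw [Int.even_add, Int.even_pow, Int.even_pow] at this
      rw [← Int.not_even_iff_odd] at ha ⊢
      tauto
    refine ⟨ha, hb, ?_⟩
    rw [← Int.not_even_iff_odd]
    rintro ⟨k, rfl⟩
    obtain ⟨i, rfl⟩ := ha
    obtain ⟨j, rfl⟩ := hb
    ring_nf at h
    omega

lemma sixteen_dvd_of_odd {a b : ℤ} (ha : Odd a) (hb : Odd b) : 16 ∣ 2 * a ^ 2 - 2 * b ^ 2 := by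
  have h8 : ∀ n : ℤ, Odd n → 8 ∣ n ^ 2 - 1 := fun n hn => Int.eight_dvd_sq_sub_one_of_odd hn
  have := h8 a ha
  have := h8 b hb
  omega

lemma IsOddAbscissa.exists_coordinates {x : ℚ} (h : IsOddAbscissa x) :
    ∃ X w : ℤ, OddCoordinates x X w := by
  obtain ⟨α, β, γ, hα, hβ, hγ⟩ := h
  have hb : (β.num : ℚ) = β * β.den := (Rat.mul_den_eq_num β).symm
  have hcop : IsCoprime β.num β.den := by
    rw [Int.isCoprime_iff_gcd_eq_one]; exact β.reduced
  have hpos : (0 : ℤ) < β.den := by exact_mod_cast β.den_pos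
  -- The denominator of β clears those of α and γ too: αw and γw have integral squares. Then X = 2b²
  -- - 2w² with b and w odd, whence 16 ∣ X.
  obtain ⟨w, hw⟩ : ∃ w : ℤ, w = β.den := ⟨_, rfl⟩
  have hww : (β.den : ℚ) = (w : ℚ) := by rw [hw]; simp
  rw [hww] at hb
  rw [← hw] at hcop hpos
  set b := β.num
  obtain ⟨a, ha⟩ := exists_int_eq_of_sq_eq (q := α * w) (n := 2 * w ^ 2 - b ^ 2) (by
    push_cast; rw [hb]; linear_combination (-(w : ℚ) ^ 2 / 2) * (hα + hβ))
  obtain ⟨g, hg⟩ := exists_int_eq_of_sq_eq (q := γ * w) (n := 56171 * w ^ 2 - 2 * b ^ 2) (by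
    push_cast; rw [hb]; linear_combination (-(w : ℚ) ^ 2) * (hγ + hβ))
  have hab : a ^ 2 + b ^ 2 = 2 * w ^ 2 := by
    have : (a : ℚ) ^ 2 + b ^ 2 = 2 * w ^ 2 := by
      rw [hb, ← ha]; linear_combination (-(w : ℚ) ^ 2 / 2) * (hα + hβ)
    exact_mod_cast this
  have hgb : 56171 * w ^ 2 - 2 * b ^ 2 = g ^ 2 := by
    have : 56171 * (w : ℚ) ^ 2 - 2 * b ^ 2 = g ^ 2 := by
      rw [hb, ← hg]; linear_combination ((w : ℚ) ^ 2) * (hγ + hβ)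
    exact_mod_cast this
  obtain ⟨oa, ob, ow⟩ := odd_and_odd_of_sq_add_sq_eq hab hcop
  refine ⟨2 * b ^ 2 - 2 * w ^ 2, w, ⟨hpos, ?_, ?_, ow, sixteen_dvd_of_odd ob ow,
    a, b, g, by linarith, by ring, by linarith, oa, ob⟩⟩
  · push_cast; rw [hb]; linear_combination ((w : ℚ) ^ 2) * hβ
  · have h2 : IsCoprime (2 : ℤ) w := by
      rw [Int.isCoprime_iff_gcd_eq_one]
      exact Int.isCoprime_iff_gcd_eq_one.mp (Int.isCoprime_two_left.mpr ow)
    have := (h2.mul_left (hcop.pow_left (m := 2))).add_mul_right_left (-2 * w)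
    rwa [show 2 * b ^ 2 + -2 * w * w = 2 * b ^ 2 - 2 * w ^ 2 by ring] at this

lemma IsEvenAbscissa.exists_coordinates {x : ℚ} (h : IsEvenAbscissa x) :
    ∃ M K : ℤ, EvenCoordinates x M K := by
  obtain ⟨α, β, γ, hα, hβ, hγ⟩ := h
  have hb : (β.num : ℚ) = β * β.den := (Rat.mul_den_eq_num β).symm
  have hcop : IsCoprime β.num β.den := by
    rw [Int.isCoprime_iff_gcd_eq_one]; exact β.reduced
  have hpos : (0 : ℤ) < β.den := by exact_mod_cast β.den_pos
  obtain ⟨w, hw⟩ : ∃ w : ℤ, w = β.den := ⟨_, rfl⟩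
  have hww : (β.den : ℚ) = (w : ℚ) := by rw [hw]; simp
  rw [hww] at hb
  rw [← hw] at hcop hpos
  set b := β.num
  obtain ⟨a, ha⟩ := exists_int_eq_of_sq_eq (q := α * w) (n := b ^ 2 - 4 * w ^ 2) (by
    push_cast; rw [hb]; linear_combination ((w : ℚ) ^ 2) * (hβ - hα))
  obtain ⟨g, hg⟩ := exists_int_eq_of_sq_eq (q := γ * w) (n := b ^ 2 - 56171 * w ^ 2) (by
    push_cast; rw [hb]; linear_combination ((w : ℚ) ^ 2) * (hβ - hγ))
  have hab : b ^ 2 - 4 * w ^ 2 = a ^ 2 := by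
    have : (b : ℚ) ^ 2 - 4 * w ^ 2 = a ^ 2 := by
      rw [hb, ← ha]; linear_combination ((w : ℚ) ^ 2) * (hα - hβ)
    exact_mod_cast this
  have hgb : b ^ 2 - 56171 * w ^ 2 = g ^ 2 := by
    have : (b : ℚ) ^ 2 - 56171 * w ^ 2 = g ^ 2 := by
      rw [hb, ← hg]; linear_combination ((w : ℚ) ^ 2) * (hγ - hβ)
    exact_mod_cast this
  refine ⟨b ^ 2 - 2 * w ^ 2, w, ⟨hpos, ?_, ?_, a, b, g, by linarith, by ring, by linarith⟩⟩
  · push_cast; rw [hb]; linear_combination ((w : ℚ) ^ 2) * hβ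
  · have := (hcop.pow_left (m := 2)).add_mul_right_left (-2 * w)
    rwa [show b ^ 2 + -2 * w * w = b ^ 2 - 2 * w ^ 2 by ring] at this

namespace OddCoordinates

variable {x : ℚ} {X w : ℤ}

lemma bounds (h : OddCoordinates x X w) : X ≤ 2 * w ^ 2 ∧ -(2 * w ^ 2) ≤ X := by
  obtain ⟨α, β, γ, hα, hβ, hγ, -⟩ := h.squares
  constructor <;> nlinarith [sq_nonneg α, sq_nonneg β]

lemma x_eq (h : OddCoordinates x X w) : x = X / (w : ℚ) ^ 2 := by
  have : (w : ℚ) ≠ 0 := by exact_mod_cast h.pos.ne'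
  rw [eq_div_iff (by positivity), h.eq]

lemma ne_zero_iff (h : OddCoordinates x X w) : x ≠ 0 ↔ X ≠ 0 := by
  have : (w : ℚ) ≠ 0 := by exact_mod_cast h.pos.ne'
  rw [h.x_eq]
  simp [this]

lemma eq_zero_of_eq_one (h : OddCoordinates x X w) (hw : w = 1) : X = 0 := by
  have h1 := h.bounds
  have h2 := h.dvd
  subst hw
  omega

lemma eq_one_of_eq_zero (h : OddCoordinates x X w) (hX : X = 0) : w = 1 := by
  have h1 := h.coprime
  have h2 := h.pos
  subst hX
  rw [isCoprime_zero_left, Int.isUnit_iff] at h1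
  omega

/-- The denominator is determined by the absolute value of the abscissa. -/
lemma unique {x' : ℚ} {X' w' : ℤ} (h : OddCoordinates x X w) (h' : OddCoordinates x' X' w')
    (e : x = x' ∨ x = -x') : w = w' := by
  have key : w ^ 2 = w' ^ 2 := by
    have e1 : (w ^ 2 * X') = w' ^ 2 * X ∨ (w ^ 2 * X') = -(w' ^ 2 * X) := by
      rcases e with e | e
      · left
        have : ((w : ℚ) ^ 2 * X') = w' ^ 2 * X := by rw [← h.eq, ← h'.eq, e]; ring
        exact_mod_cast this
      · right
        have : ((w : ℚ) ^ 2 * X') = -(w' ^ 2 * X) := by rw [← h.eq, ← h'.eq, e]; ring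
        exact_mod_cast this
    have c1 : IsCoprime (w ^ 2) X := h.coprime.symm.pow_left
    have c2 : IsCoprime (w' ^ 2) X' := h'.coprime.symm.pow_left
    refine Int.dvd_antisymm (sq_nonneg _) (sq_nonneg _) (c1.dvd_of_dvd_mul_right ?_)
      (c2.dvd_of_dvd_mul_right ?_)
    · rcases e1 with e1 | e1
      · exact ⟨X', e1.symm⟩
      · exact ⟨-X', by linarith⟩
    · rcases e1 with e1 | e1
      · exact ⟨X, e1⟩
      · exact ⟨-X, by linarith⟩
  exact (sq_eq_sq₀ h.pos.le h'.pos.le).mp key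

end OddCoordinates

namespace EvenCoordinates

variable {x : ℚ} {M K : ℤ}

lemma bound (h : EvenCoordinates x M K) : 56169 * K ^ 2 ≤ M := by
  obtain ⟨α, β, γ, hα, hβ, hγ⟩ := h.squares
  nlinarith [sq_nonneg γ]

lemma le (h : EvenCoordinates x M K) : 56169 ≤ M := by
  nlinarith [h.bound, h.pos]

/-- M is never divisible by 4: if M is even, then K is odd and α = 2i, so M/2 = K² + 2i² is odd. -/
lemma odd_or (h : EvenCoordinates x M K) : Odd M ∨ Odd K ∧ ∃ N, M = 2 * N ∧ Odd N := by
  obtain ⟨α, β, γ, hα, hβ, hγ⟩ := h.squares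
  rcases Int.even_or_odd M with hM | hM
  · right
    have hK : Odd K := by
      rw [← Int.not_even_iff_odd]
      intro hK
      exact h.coprime.not_prime_dvd Int.prime_two hM.two_dvd hK.two_dvd
    refine ⟨hK, ?_⟩
    obtain ⟨N, hN⟩ := hM.two_dvd
    refine ⟨N, hN, ?_⟩
    have hα2 : Even α := by
      have : Even (α ^ 2) := by rw [← hα]; exact hM.sub (even_two_mul _)
      rw [Int.even_pow] at this
      exact this.1
    obtain ⟨i, rfl⟩ := hα2
    have hK2 := hK.pow (n := 2)
    have : N = K ^ 2 + 2 * i ^ 2 := by linarith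
    rw [this]
    exact hK2.add_even (even_two_mul _)
  · exact .inl hM

end EvenCoordinates

/-! ### Numerators and denominators of neighbouring points -/

/-- The coordinates of `Q ± basePoint` for a point `Q` in the class of `basePoint`. -/
lemma OddCoordinates.neighbours {x u v : ℚ} {X w M K M' K' : ℤ} (h : OddCoordinates x X w)
    (hu : EvenCoordinates u M K) (hv : EvenCoordinates v M' K') (hX : X ≠ 0)
    (hs : (u + v) * x ^ 2 = 8 * (112338 - x))
    (hp : u * v * x ^ 2 = 16 * (3154956562 - 56169 * x)) :
    M * M' = w ^ 2 * (3154956562 * w ^ 2 - 56169 * X) ∧ (Odd K ∨ Odd K') := by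
  have hw := h.odd
  have hc := h.coprime
  obtain ⟨Y, rfl⟩ := h.dvd
  have hY : Y ≠ 0 := by rintro rfl; simp at hX
  have hK0 := hu.pos
  have hK0' := hv.pos
  have hw0 := h.pos
  have eK := hu.eq
  have eK' := hv.eq
  have ex := h.eq
  -- The triple from the formulas for u + v and uv, divided by 16. Its middle entry is odd, which
  -- gives primitivity at 2 and later excludes that K and K' are both even.
  have prim : IsPrimitiveTriple (16 * Y ^ 2) (w ^ 2 * (56169 * w ^ 2 - 8 * Y))
      (w ^ 2 * (3154956562 * w ^ 2 - 56169 * (16 * Y))) := by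
    intro l hl h1 h2 h3
    have hodd : Odd (w ^ 2 * (56169 * w ^ 2 - 8 * Y)) := by
      have hw2 := hw.pow (n := 2)
      refine hw2.mul (Odd.sub_even (Odd.mul (by decide) hw2) ⟨4 * Y, by ring⟩)
    have hl2 : ¬ l ∣ 2 := fun hd => by
      have : (2 : ℤ) ∣ l := (Int.prime_two.dvd_prime_iff_associated hl).mpr
        ((hl.dvd_prime_iff_associated Int.prime_two).mp hd).symm
      exact (Int.not_even_iff_odd.mpr hodd) (even_iff_two_dvd.mpr (this.trans h2))
    have hlY : l ∣ Y := by
      rcases hl.dvd_or_dvd h1 with h4 | h4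
      · exact absurd (hl.dvd_of_dvd_pow (show l ∣ 2 ^ 4 by norm_num; exact h4)) hl2
      · exact hl.dvd_of_dvd_pow h4
    have hlw : ¬ l ∣ w := fun hd => hc.not_prime_dvd hl (hlY.mul_left 16) hd
    have hlw2 : ¬ l ∣ w ^ 2 := fun hd => hlw (hl.dvd_of_dvd_pow hd)
    have h4 : l ∣ 56169 * w ^ 2 := by
      have := (hl.dvd_or_dvd h2).resolve_left hlw2
      exact (dvd_sub_left (hlY.mul_left 8)).mp this
    have h5 : l ∣ 3154956562 * w ^ 2 := by
      have := (hl.dvd_or_dvd h3).resolve_left hlw2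
      exact (dvd_sub_left ((hlY.mul_left 16).mul_left _)).mp this
    have h6 := (hl.dvd_or_dvd h4).resolve_right hlw2
    have h7 := (hl.dvd_or_dvd h5).resolve_right hlw2
    have h8 : l ∣ 1 := by
      have := dvd_sub h7 (h6.mul_left 56169)
      norm_num at this
      exact this
    exact hl.not_isUnit (isUnit_iff_dvd_one.mpr h8)
  have prim' := isPrimitiveTriple_mul (hu.coprime.pow_right (n := 2)) (hv.coprime.pow_right (n := 2))
  obtain ⟨-, e2, e3⟩ := prim'.eq prim (by positivity) (by positivity)
    (by
      have : ((K : ℚ) ^ 2 * K' ^ 2) * (w ^ 2 * (56169 * w ^ 2 - 8 * Y)) =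
          16 * Y ^ 2 * (M * K' ^ 2 + M' * K ^ 2) := by
        rw [← eK, ← eK']
        push_cast at ex
        have hY' : (Y : ℚ) = x * w ^ 2 / 16 := by linarith
        rw [hY']
        linear_combination (-(K : ℚ) ^ 2 * K' ^ 2 * w ^ 4 / 16) * hs
      exact_mod_cast this)
    (by
      have : ((K : ℚ) ^ 2 * K' ^ 2) * (w ^ 2 * (3154956562 * w ^ 2 - 56169 * (16 * Y))) =
          16 * Y ^ 2 * (M * M') := by
        rw [← eK, ← eK']
        push_cast at ex
        have hY' : (Y : ℚ) = x * w ^ 2 / 16 := by linarith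
        rw [hY']
        linear_combination (-(K : ℚ) ^ 2 * K' ^ 2 * w ^ 4 / 16) * hp
      exact_mod_cast this)
  refine ⟨e3, ?_⟩
  by_contra hcon
  rw [not_or, Int.not_odd_iff_even, Int.not_odd_iff_even] at hcon
  have hodd : Odd (w ^ 2 * (56169 * w ^ 2 - 8 * Y)) := by
    have hw2 := hw.pow (n := 2)
    refine hw2.mul (Odd.sub_even (Odd.mul (by decide) hw2) ⟨4 * Y, by ring⟩)
  rw [← e2, ← Int.not_even_iff_odd] at hodd
  exact hodd (((hcon.2.pow_of_ne_zero two_ne_zero).mul_left M).add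
    ((hcon.1.pow_of_ne_zero two_ne_zero).mul_left M'))

/-- 3154956562 = 56169² + 1. -/
lemma not_prime_dvd_of_dvd_of_dvd {l : ℤ} (hl : Prime l) (h : l ∣ 56169)
    (h' : l ∣ 3154956562) : False := by
  have := dvd_sub h' (h.mul_left 56169)
  norm_num at this
  exact hl.not_isUnit (isUnit_iff_dvd_one.mpr this)

/-- The coordinates of `P ± basePoint` for a point `P` in the trivial class. -/
lemma EvenCoordinates.neighbours {x u v : ℚ} {M K X w X' w' : ℤ} (h : EvenCoordinates x M K)
    (hu : OddCoordinates u X w) (hv : OddCoordinates v X' w')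
    (hs : (u + v) * x ^ 2 = 8 * (112338 - x))
    (hp : u * v * x ^ 2 = 16 * (3154956562 - 56169 * x)) : M ≤ 2 * (w * w') := by
  have hK0 := h.pos
  have hM0 : 0 < M := by linarith [h.le]
  have hw0 := hu.pos
  have hw0' := hv.pos
  have eX := hu.eq
  have eX' := hv.eq
  have ex := h.eq
  have prim' := isPrimitiveTriple_mul (hu.coprime.pow_right (n := 2)) (hv.coprime.pow_right (n := 2))
  have r1 : (w ^ 2 * w' ^ 2) * (8 * K ^ 2 * (112338 * K ^ 2 - M)) =
      M ^ 2 * (X * w' ^ 2 + X' * w ^ 2) := by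
    have : ((w : ℚ) ^ 2 * w' ^ 2) * (8 * K ^ 2 * (112338 * K ^ 2 - M)) =
        M ^ 2 * (X * w' ^ 2 + X' * w ^ 2) := by
      rw [← eX, ← eX', ← ex]
      linear_combination (-(w : ℚ) ^ 2 * w' ^ 2 * K ^ 4) * hs
    exact_mod_cast this
  have r2 : (w ^ 2 * w' ^ 2) * (16 * K ^ 2 * (3154956562 * K ^ 2 - 56169 * M)) =
      M ^ 2 * (X * X') := by
    have : ((w : ℚ) ^ 2 * w' ^ 2) * (16 * K ^ 2 * (3154956562 * K ^ 2 - 56169 * M)) =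
        M ^ 2 * (X * X') := by
      rw [← eX, ← eX', ← ex]
      linear_combination (-(w : ℚ) ^ 2 * w' ^ 2 * K ^ 4) * hp
    exact_mod_cast this
  -- For odd M the triple is already primitive and M = ww'. For M = 2N it becomes primitive after
  -- division by 4, and N = ww'.
  have key : M ^ 2 ≤ (2 * (w * w')) ^ 2 := by
    rcases h.odd_or with hM | ⟨hK, N, rfl, hN⟩
    · have prim : IsPrimitiveTriple (M ^ 2) (8 * K ^ 2 * (112338 * K ^ 2 - M))
          (16 * K ^ 2 * (3154956562 * K ^ 2 - 56169 * M)) := by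
        intro l hl h1 h2 h3
        have hlM := hl.dvd_of_dvd_pow h1
        have hl2 : ¬ l ∣ 2 := fun hd => (Int.isCoprime_two_left.mpr hM).not_prime_dvd hl hd hlM
        have hlK : ¬ l ∣ K ^ 2 := fun hd => h.coprime.not_prime_dvd hl hlM (hl.dvd_of_dvd_pow hd)
        have hl8 : ¬ l ∣ 8 * K ^ 2 := fun hd => (hl.dvd_or_dvd hd).elim
          (fun hd => hl2 (hl.dvd_of_dvd_pow (show l ∣ 2 ^ 3 by norm_num; exact hd))) hlK
        have hl16 : ¬ l ∣ 16 * K ^ 2 := fun hd => (hl.dvd_or_dvd hd).elim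
          (fun hd => hl2 (hl.dvd_of_dvd_pow (show l ∣ 2 ^ 4 by norm_num; exact hd))) hlK
        have h4 := (dvd_sub_left hlM).mp ((hl.dvd_or_dvd h2).resolve_left hl8)
        have h5 := (dvd_sub_left (hlM.mul_left _)).mp ((hl.dvd_or_dvd h3).resolve_left hl16)
        have h6 := (hl.dvd_or_dvd h4).resolve_right hlK
        refine not_prime_dvd_of_dvd_of_dvd hl ?_ ((hl.dvd_or_dvd h5).resolve_right hlK)
        exact (hl.dvd_or_dvd (show l ∣ 2 * 56169 by norm_num; exact h6)).resolve_left hl2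
      obtain ⟨e1, -, -⟩ := prim'.eq prim (by positivity) (by positivity) r1 r2
      nlinarith [sq_nonneg (w * w')]
    · have hN0 : 0 < N := by linarith
      have prim : IsPrimitiveTriple (N ^ 2) (4 * K ^ 2 * (56169 * K ^ 2 - N))
          (4 * K ^ 2 * (3154956562 * K ^ 2 - 56169 * (2 * N))) := by
        intro l hl h1 h2 h3
        have hlM := hl.dvd_of_dvd_pow h1
        have hl2 : ¬ l ∣ 2 := fun hd => (Int.isCoprime_two_left.mpr hN).not_prime_dvd hl hd hlM
        have hlK : ¬ l ∣ K ^ 2 := fun hd =>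
          h.coprime.not_prime_dvd hl (hlM.mul_left 2) (hl.dvd_of_dvd_pow hd)
        have hl4 : ¬ l ∣ 4 * K ^ 2 := fun hd => (hl.dvd_or_dvd hd).elim
          (fun hd => hl2 (hl.dvd_of_dvd_pow (show l ∣ 2 ^ 2 by norm_num; exact hd))) hlK
        have h4 := (dvd_sub_left hlM).mp ((hl.dvd_or_dvd h2).resolve_left hl4)
        have h5 := (dvd_sub_left ((hlM.mul_left 2).mul_left _)).mp
          ((hl.dvd_or_dvd h3).resolve_left hl4)
        exact not_prime_dvd_of_dvd_of_dvd hl ((hl.dvd_or_dvd h4).resolve_right hlK)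
          ((hl.dvd_or_dvd h5).resolve_right hlK)
      obtain ⟨e1, -, -⟩ := prim'.eq prim (by positivity) (by positivity)
        (by linarith [r1]) (by linarith [r2])
      nlinarith [sq_nonneg (w * w')]
  exact le_of_sq_le_sq key (by positivity)

/-! ### The numerator of a double -/

/-- The primes 56167 and 56171 are 237² ∓ 2, the differences between the 2-torsion abscissa 237² and
±2. -/
lemma prime_56167 : Prime (56167 : ℤ) :=
  Nat.prime_iff_prime_int.mp (by norm_num : Nat.Prime 56167)

lemma prime_56171 : Prime (56171 : ℤ) :=
  Nat.prime_iff_prime_int.mp (by norm_num : Nat.Prime 56171)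

/-- The right side is divisible by l², whereas q contains l only once. -/
lemma Prime.dvd_of_mul_eq_sq_add_sq {l q W a b e : ℤ} (hl : Prime l) (hq : Prime q) (hlq : l ∣ q)
    (ha : l ∣ a) (hb : l ∣ b) (h : q * W = a ^ 2 + e * b ^ 2) : l ∣ W := by
  obtain ⟨s, rfl⟩ := ((hl.dvd_prime_iff_associated hq).mp hlq).symm.dvd
  obtain ⟨a', rfl⟩ := ha
  obtain ⟨b', rfl⟩ := hb
  refine ⟨s * (a' ^ 2 + e * b' ^ 2), mul_left_cancel₀ hq.ne_zero ?_⟩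
  linear_combination h

lemma isCoprime_of_forall_prime {a b : ℤ} (hb : b ≠ 0)
    (h : ∀ l : ℤ, Prime l → l ∣ a → l ∣ b → False) : IsCoprime a b :=
  isCoprime_of_prime_dvd (fun h0 => hb h0.2) (fun l hl ha hb => h l hl ha hb)

lemma Prime.not_dvd_two_pow {l n : ℤ} (hl : Prime l) (hn : Odd n) (h : l ∣ n) (k : ℕ) :
    ¬ l ∣ 2 ^ k :=
  fun hd => (Int.isCoprime_two_left.mpr hn).not_prime_dvd hl (hl.dvd_of_dvd_pow hd) h

/-- At a root e of the cubic, the duplication numerator is the square of the derivative of the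
cubic. A common prime must therefore be 56167 or 56171, and then the relations among α, β, γ make it
divide w as well, hence X. -/
lemma OddCoordinates.isCoprime_double {x : ℚ} {X w : ℤ} (h : OddCoordinates x X w)
    {α β γ n : ℤ} (hα : 2 * w ^ 2 - X = 2 * α ^ 2) (hβ : 2 * w ^ 2 + X = 2 * β ^ 2)
    (hγ : 56169 * w ^ 2 - X = γ ^ 2) (oα : Odd α) (oβ : Odd β)
    (hn : 16 * n = X ^ 4 + 8 * X ^ 2 * (w ^ 2) ^ 2 - 1797408 * X * (w ^ 2) ^ 3 +
      50479304992 * (w ^ 2) ^ 4) : IsCoprime n (w * α * β * γ) := by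
  have hw0 := h.pos
  have hlw : ∀ l : ℤ, Prime l → l ∣ X → ¬ l ∣ w ^ 2 := fun l hl hX hd =>
    h.coprime.not_prime_dvd hl hX (hl.dvd_of_dvd_pow hd)
  have oγ : Odd γ := by
    have h1 : Odd (γ ^ 2) := by
      rw [← hγ]
      refine (Odd.mul (by decide) h.odd.pow).sub_even ?_
      exact even_iff_two_dvd.mpr (.trans (by norm_num) h.dvd)
    rw [← Int.not_even_iff_odd] at h1 ⊢
    exact fun h2 => h1 (h2.pow_of_ne_zero two_ne_zero)
  have ne_zero_of_odd : ∀ {a : ℤ}, Odd a → a ≠ 0 := by rintro a ha rfl; simp at ha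
  refine .mul_right (.mul_right (.mul_right ?_ ?_) ?_) ?_
  · refine isCoprime_of_forall_prime hw0.ne' fun l hl ln lw => ?_
    have lw2 : l ∣ w ^ 2 := dvd_pow lw two_ne_zero
    have : l ∣ X ^ 4 := by
      have e : X ^ 4 = 16 * n - w ^ 2 * (8 * X ^ 2 * w ^ 2 - 1797408 * X * (w ^ 2) ^ 2 +
        50479304992 * (w ^ 2) ^ 3) := by linear_combination -hn
      rw [e]
      exact dvd_sub (ln.mul_left _) (lw2.mul_right _)
    exact hlw l hl (hl.dvd_of_dvd_pow this) lw2
  · refine isCoprime_of_forall_prime (ne_zero_of_odd oα) fun l hl ln la => ?_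
    have hX : X = 2 * w ^ 2 - 2 * α ^ 2 := by linarith
    have h2 := hl.not_dvd_two_pow oα la
    have lW : ¬ l ∣ w ^ 2 := fun hd => hlw l hl (by
      rw [hX]; exact dvd_sub (hd.mul_left _) ((dvd_pow la two_ne_zero).mul_left _)) hd
    have h3 : l ∣ 2 ^ 4 * (56167 ^ 2 * (w ^ 2) ^ 4) := by
      subst hX
      have e : 2 ^ 4 * (56167 ^ 2 * (w ^ 2) ^ 4) = 16 * n - α *
          (α * (16 * α ^ 6 - 64 * α ^ 4 * w ^ 2 + 128 * α ^ 2 * (w ^ 2) ^ 2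
            + 3594688 * (w ^ 2) ^ 3)) := by linear_combination -hn
      rw [e]
      exact dvd_sub (ln.mul_left _) (la.mul_right _)
    have h4 := (hl.dvd_or_dvd h3).resolve_left (h2 4)
    have h5 := hl.dvd_of_dvd_pow
      ((hl.dvd_or_dvd h4).resolve_right fun hd => lW (hl.dvd_of_dvd_pow hd))
    have h6 : l ∣ γ ^ 2 := by
      have e : γ ^ 2 = 56167 * w ^ 2 + α * (2 * α) := by linarith
      rw [e]; exact dvd_add (h5.mul_right _) (la.mul_right _)
    exact lW (hl.dvd_of_mul_eq_sq_add_sq prime_56167 h5 (hl.dvd_of_dvd_pow h6) la (e := -2)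
      (by linarith))
  · refine isCoprime_of_forall_prime (ne_zero_of_odd oβ) fun l hl ln la => ?_
    have hX : X = 2 * β ^ 2 - 2 * w ^ 2 := by linarith
    have h2 := hl.not_dvd_two_pow oβ la
    have lW : ¬ l ∣ w ^ 2 := fun hd => hlw l hl (by
      rw [hX]; exact dvd_sub ((dvd_pow la two_ne_zero).mul_left _) (hd.mul_left _)) hd
    have h3 : l ∣ 2 ^ 4 * (56171 ^ 2 * (w ^ 2) ^ 4) := by
      subst hX
      have e : 2 ^ 4 * (56171 ^ 2 * (w ^ 2) ^ 4) = 16 * n - β *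
          (β * (16 * β ^ 6 - 64 * β ^ 4 * w ^ 2 + 128 * β ^ 2 * (w ^ 2) ^ 2
            - 3594944 * (w ^ 2) ^ 3)) := by linear_combination -hn
      rw [e]
      exact dvd_sub (ln.mul_left _) (la.mul_right _)
    have h4 := (hl.dvd_or_dvd h3).resolve_left (h2 4)
    have h5 := hl.dvd_of_dvd_pow
      ((hl.dvd_or_dvd h4).resolve_right fun hd => lW (hl.dvd_of_dvd_pow hd))
    have h6 : l ∣ γ ^ 2 := by
      have e : γ ^ 2 = 56171 * w ^ 2 - β * (2 * β) := by linarith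
      rw [e]; exact dvd_sub (h5.mul_right _) (la.mul_right _)
    exact lW (hl.dvd_of_mul_eq_sq_add_sq prime_56171 h5 (hl.dvd_of_dvd_pow h6) la (e := 2)
      (by linarith))
  · refine isCoprime_of_forall_prime (ne_zero_of_odd oγ) fun l hl ln la => ?_
    have hX : X = 56169 * w ^ 2 - γ ^ 2 := by linarith
    have h2 := hl.not_dvd_two_pow oγ la 1
    have lW : ¬ l ∣ w ^ 2 := fun hd => hlw l hl (by
      rw [hX]; exact dvd_sub (hd.mul_left _) (dvd_pow la two_ne_zero)) hd
    have h3 : l ∣ (56167 * 56171) ^ 2 * (w ^ 2) ^ 4 := by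
      have e : (56167 * 56171) ^ 2 * (w ^ 2) ^ 4 = 16 * n + γ * (γ * ((X + 56169 * w ^ 2) *
          (X ^ 2 + (56169 * w ^ 2) ^ 2 + 8 * (w ^ 2) ^ 2) - 1797408 * (w ^ 2) ^ 3)) := by
        linear_combination -hn + ((X + 56169 * w ^ 2) *
          (X ^ 2 + (56169 * w ^ 2) ^ 2 + 8 * (w ^ 2) ^ 2) - 1797408 * (w ^ 2) ^ 3) * hγ
      rw [e]
      exact dvd_add (ln.mul_left _) (la.mul_right _)
    have h4 := hl.dvd_of_dvd_pow
      ((hl.dvd_or_dvd h3).resolve_right fun hd => lW (hl.dvd_of_dvd_pow hd))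
    rcases hl.dvd_or_dvd h4 with h5 | h5
    · have h6 : l ∣ 2 ^ 1 * α ^ 2 := by
        have e : 2 ^ 1 * α ^ 2 = γ * γ - 56167 * w ^ 2 := by linarith
        rw [e]; exact dvd_sub (la.mul_right _) (h5.mul_right _)
      have h7 := hl.dvd_of_dvd_pow ((hl.dvd_or_dvd h6).resolve_left h2)
      exact lW (hl.dvd_of_mul_eq_sq_add_sq prime_56167 h5 la h7 (e := -2) (by linarith))
    · have h6 : l ∣ 2 ^ 1 * β ^ 2 := by
        have e : 2 ^ 1 * β ^ 2 = 56171 * w ^ 2 - γ * γ := by linarith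
        rw [e]; exact dvd_sub (h5.mul_right _) (la.mul_right _)
      have h7 := hl.dvd_of_dvd_pow ((hl.dvd_or_dvd h6).resolve_left h2)
      exact lW (hl.dvd_of_mul_eq_sq_add_sq prime_56171 h5 la h7 (e := 2) (by linarith))

/-- A lower bound for the numerator of the abscissa of twice a point in the class of `basePoint`. -/
lemma OddCoordinates.le_of_double {x u : ℚ} {X w M K : ℤ} (h : OddCoordinates x X w)
    (hu : EvenCoordinates u M K)
    (hd : u * (4 * ((x - 56169) * (x ^ 2 - 4))) =
      x ^ 4 + 8 * x ^ 2 - 1797408 * x + 50479304992) : 3154731886 * w ^ 8 ≤ M := by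
  have hw0 := h.pos
  obtain ⟨α, β, γ, hα, hβ, hγ, oα, oβ⟩ := h.squares
  obtain ⟨Y, hY⟩ := h.dvd
  obtain ⟨n, hn⟩ : ∃ n, n = 4096 * Y ^ 4 + 128 * Y ^ 2 * (w ^ 2) ^ 2 -
    1797408 * Y * (w ^ 2) ^ 3 + 3154956562 * (w ^ 2) ^ 4 := ⟨_, rfl⟩
  have hn' : 16 * n = X ^ 4 + 8 * X ^ 2 * (w ^ 2) ^ 2 - 1797408 * X * (w ^ 2) ^ 3 +
      50479304992 * (w ^ 2) ^ 4 := by rw [hn, hY]; ring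
  have hc := h.isCoprime_double hα hβ hγ oα oβ hn'
  have key : M * (w * α * β * γ) ^ 2 = K ^ 2 * n := by
    have q1 : (2 * (w : ℚ) ^ 2 - X) = 2 * α ^ 2 := by exact_mod_cast hα
    have q2 : (2 * (w : ℚ) ^ 2 + X) = 2 * β ^ 2 := by exact_mod_cast hβ
    have q3 : (56169 * (w : ℚ) ^ 2 - X) = γ ^ 2 := by exact_mod_cast hγ
    have q4 : 16 * (n : ℚ) = X ^ 4 + 8 * X ^ 2 * (w ^ 2) ^ 2 - 1797408 * X * (w ^ 2) ^ 3 +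
      50479304992 * (w ^ 2) ^ 4 := by exact_mod_cast hn'
    have : (M : ℚ) * (w * α * β * γ) ^ 2 = K ^ 2 * n := by
      have e1 : (16 : ℚ) * (w * α * β * γ) ^ 2 =
          4 * w ^ 2 * (2 * w ^ 2 - X) * (2 * w ^ 2 + X) * (56169 * w ^ 2 - X) := by
        rw [q1, q2, q3]; ring
      rw [← h.eq] at e1 q4
      rw [← hu.eq]
      linear_combination (u * K ^ 2 / 16) * e1 - K ^ 2 / 16 * q4 + (K ^ 2 * w ^ 8 / 16) * hd
    exact_mod_cast this
  have hM0 : 0 < M := by linarith [hu.le]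
  have hdvd : n ∣ M := (hc.pow_right (n := 2)).dvd_of_dvd_mul_right ⟨K ^ 2, by linarith⟩
  refine le_trans ?_ (Int.le_of_dvd hM0 hdvd)
  have hb := h.bounds.1
  -- From X ≤ 2w² one gets 8Y ≤ w², and 224676 = 1797408 / 8. The final constant is 3154956562 -
  -- 224676.
  have : 1797408 * Y * (w ^ 2) ^ 3 ≤ 224676 * (w ^ 2) ^ 4 := by
    have h8 : 0 ≤ 224676 * (w ^ 2) ^ 3 := by positivity
    have : Y * 8 ≤ w ^ 2 := by linarith
    nlinarith
  have : 0 ≤ 4096 * Y ^ 4 + 128 * Y ^ 2 * (w ^ 2) ^ 2 := by positivity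
  nlinarith

/-! ### Halving points of the trivial class -/

/-- The explicit half of a point all of whose square classes are trivial. -/
lemma exists_half {u y a b d : ℚ} (h : y ^ 2 = (u - 56169) * (u ^ 2 - 4)) (ha : u - 56169 = a ^ 2)
    (hb : u - 2 = b ^ 2) (hd : u + 2 = d ^ 2) (hab : a + b ≠ 0) (had : a + d ≠ 0)
    (hbd : b + d ≠ 0) : ∃ y' h', affinePoint (u + (a * b + b * d + d * a)) y' h' +
      affinePoint (u + (a * b + b * d + d * a)) y' h' = affinePoint u y h := by
  obtain ⟨e, he, hy⟩ : ∃ e : ℚ, e ^ 2 = 1 ∧ y = e * (a * b * d) := by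
    have : y ^ 2 = (a * b * d) ^ 2 := by
      rw [h, mul_pow, mul_pow, ← ha, ← hb, ← hd]; ring
    rcases sq_eq_sq_iff_eq_or_eq_neg.mp this with e | e
    · exact ⟨1, by norm_num, by rw [e]; ring⟩
    · exact ⟨-1, by norm_num, by rw [e]; ring⟩
  have he0 : e ≠ 0 := by rintro rfl; norm_num at he
  -- The differences of the half to the three roots factor into pairwise sums of a, b, d, so the
  -- signs of the roots decide the square class of the half.
  have q1 : u + (a * b + b * d + d * a) - 56169 = (a + b) * (a + d) := by linear_combination ha
  have q2 : u + (a * b + b * d + d * a) - 2 = (a + b) * (b + d) := by linear_combination hb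
  have q3 : u + (a * b + b * d + d * a) + 2 = (a + d) * (b + d) := by linear_combination hd
  have hy' : (e * ((a + b) * (b + d) * (a + d))) ^ 2 =
      (u + (a * b + b * d + d * a) - 56169) * ((u + (a * b + b * d + d * a)) ^ 2 - 4) := by
    rw [show (u + (a * b + b * d + d * a)) ^ 2 - 4 = (u + (a * b + b * d + d * a) - 2) *
      (u + (a * b + b * d + d * a) + 2) by ring, q1, q2, q3, mul_pow, he]
    ring
  refine ⟨_, hy', ?_⟩
  obtain ⟨h2, e2⟩ := affinePoint_add_self (l := e * (a + b + d)) hy'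
    (mul_ne_zero he0 (mul_ne_zero (mul_ne_zero hab hbd) had)) (by
      obtain ⟨z, hz⟩ : ∃ z, z = u + (a * b + b * d + d * a) := ⟨_, rfl⟩
      rw [← hz] at q1 q2 q3 ⊢
      have : 3 * z ^ 2 - 112338 * z - 4 = (z - 56169) * (z - 2) + (z - 56169) * (z + 2) +
        (z - 2) * (z + 2) := by ring
      rw [this, q1, q2, q3]
      linear_combination (2 * (a + b + d) * ((a + b) * (b + d) * (a + d))) * he)
  rw [e2]
  have hx : (e * (a + b + d)) ^ 2 + 56169 - (u + (a * b + b * d + d * a)) -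
      (u + (a * b + b * d + d * a)) = u := by
    rw [mul_pow, he]
    linear_combination -ha - hb - hd
  refine affinePoint_congr hx ?_
  rw [hx, hy]
  ring

/-- Here q ∣ V, and U · (V/q) = K². A common prime of these two cofactors is odd and divides K and U
- V = 2a, against coprimality. -/
lemma eq_sq_or_eq_neg_sq_of_mul_eq {q U V K a : ℤ} (hq : Prime q) (h : U * V = q * K ^ 2)
    (hodd : Odd U) (hac : IsCoprime a K) (ha : U - V = 2 * a) (hqU : ¬ q ∣ U) :
    ∃ s, U = s ^ 2 ∨ U = -s ^ 2 := by
  have hU0 : U ≠ 0 := by rintro rfl; simp at hodd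
  obtain ⟨D, rfl⟩ : q ∣ V := (hq.dvd_or_dvd (Dvd.intro _ h.symm)).resolve_left hqU
  have hD : U * D = K ^ 2 := mul_left_cancel₀ hq.ne_zero (by linear_combination h)
  refine Int.sq_of_isCoprime (isCoprime_of_forall_prime hU0 fun l hl lD lU => ?_).symm hD
  have l2 := hl.not_dvd_two_pow hodd lU 1
  have lK : l ∣ K := hl.dvd_of_dvd_pow (hD ▸ lU.mul_right D)
  have la : l ∣ 2 ^ 1 * a := by
    rw [pow_one, ← ha]; exact dvd_sub lU (lD.mul_left q)
  exact hac.not_prime_dvd hl ((hl.dvd_or_dvd la).resolve_left l2) lK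

lemma exists_sign_not_dvd {q a b K : ℤ} (hq : Prime q) (hq2 : ¬ q ∣ 2)
    (h : b ^ 2 - a ^ 2 = q * K ^ 2) (hac : IsCoprime a K) :
    ¬ q ∣ b + a ∨ ¬ q ∣ b - a := by
  by_contra hcon
  rw [not_or, not_not, not_not] at hcon
  have h1 : q ∣ 2 * a := by
    have := dvd_sub hcon.1 hcon.2
    rwa [show b + a - (b - a) = 2 * a by ring] at this
  have h2 := (hq.dvd_or_dvd h1).resolve_left hq2
  obtain ⟨i, hi⟩ := hcon.1
  obtain ⟨j, hj⟩ := hcon.2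
  have : K ^ 2 = q * (i * j) := mul_left_cancel₀ hq.ne_zero (by
    rw [← h, show b ^ 2 - a ^ 2 = (b + a) * (b - a) by ring, hi, hj]; ring)
  exact hac.not_prime_dvd hq h2 (hq.dvd_of_dvd_pow (Dvd.intro _ this.symm))

/-- The choice of signs of the square roots for which the half lies in the class of `basePoint`. -/
lemma EvenCoordinates.exists_signs {x : ℚ} {M K : ℤ} (h : EvenCoordinates x M K) (hK : Odd K) :
    ∃ a b d r s t : ℤ, M - 56169 * K ^ 2 = a ^ 2 ∧ M - 2 * K ^ 2 = b ^ 2 ∧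
      M + 2 * K ^ 2 = d ^ 2 ∧ a + b = -r ^ 2 ∧ a + d = s ^ 2 ∧ b + d = 2 * t ^ 2 ∧
      r ≠ 0 ∧ s ≠ 0 ∧ t ≠ 0 := by
  have hK0 := h.pos
  obtain ⟨b, d, a, hb, hd, ha⟩ := h.squares
  have hac : IsCoprime a K := by
    refine isCoprime_of_forall_prime hK0.ne' fun l hl la lK => ?_
    refine h.coprime.not_prime_dvd hl ?_ lK
    have : M = a * a + K * (56169 * K) := by linarith
    rw [this]
    exact dvd_add (la.mul_right _) (lK.mul_right _)
  have hbd : ¬ (56167 : ℤ) ∣ 2 := by norm_num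
  have hdd : ¬ (56171 : ℤ) ∣ 2 := by norm_num
  -- Signs are fixed in turn: d ≥ 0, then a with 56171 ∤ d + a, then b with 56167 ∤ b + a. These use
  -- d² - a² = 56171K² and b² - a² = 56167K².
  obtain ⟨d, hd, hd0⟩ : ∃ d', M + 2 * K ^ 2 = d' ^ 2 ∧ 0 ≤ d' :=
    ⟨|d|, by rw [sq_abs, hd], abs_nonneg d⟩
  obtain ⟨a, ha, hac, had⟩ : ∃ a', M - 56169 * K ^ 2 = a' ^ 2 ∧ IsCoprime a' K ∧
      ¬ (56171 : ℤ) ∣ d + a' := by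
    rcases exists_sign_not_dvd prime_56171 hdd (b := d) (by linarith) hac with h1 | h1
    · exact ⟨a, ha, hac, h1⟩
    · exact ⟨-a, by rw [neg_sq, ha], hac.neg_left, by rwa [← sub_eq_add_neg]⟩
  obtain ⟨b, hb, hab⟩ : ∃ b', M - 2 * K ^ 2 = b' ^ 2 ∧ ¬ (56167 : ℤ) ∣ b' + a := by
    rcases exists_sign_not_dvd prime_56167 hbd (b := b) (by linarith) hac with h1 | h1
    · exact ⟨b, hb, h1⟩
    · refine ⟨-b, by rw [neg_sq, hb], fun h2 => h1 ?_⟩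
      rw [← dvd_neg]
      rwa [neg_sub, sub_eq_neg_add]
  have h8 : ∀ n : ℤ, Odd n → 8 ∣ n ^ 2 - 1 := fun n hn => Int.eight_dvd_sq_sub_one_of_odd hn
  have hK8 := h8 K hK
  have oddA : Odd a := by
    rw [← Int.not_even_iff_odd]
    rintro ⟨i, rfl⟩
    have hdo : Odd d := by
      rw [← Int.not_even_iff_odd]
      rintro ⟨j, rfl⟩
      ring_nf at ha hd
      omega
    have := h8 d hdo
    ring_nf at ha
    omega
  have ha8 := h8 a oddA
  have evenB : Even b := by
    rw [← Int.not_odd_iff_even]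
    intro ho
    have := h8 b ho
    omega
  have evenD : Even d := by
    rw [← Int.not_odd_iff_even]
    intro ho
    have := h8 d ho
    omega
  have hda : 0 < d + a := by
    have : |a| < |d| := sq_lt_sq.mp (by nlinarith)
    rw [abs_of_nonneg hd0] at this
    linarith [neg_abs_le a]
  have hdb : 0 < d + b := by
    have : |b| < |d| := sq_lt_sq.mp (by nlinarith)
    rw [abs_of_nonneg hd0] at this
    linarith [neg_abs_le b]
  have oda : Odd (d + a) := evenD.add_odd oddA
  have oba : Odd (b + a) := evenB.add_odd oddA
  obtain ⟨s, hs⟩ := eq_sq_or_eq_neg_sq_of_mul_eq (V := d - a) (K := K) (a := a) prime_56171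
    (by linarith) oda hac (by ring) had
  obtain ⟨r, hr⟩ := eq_sq_or_eq_neg_sq_of_mul_eq (V := b - a) (K := K) (a := a) prime_56167
    (by linarith) oba hac (by ring) hab
  replace hs : d + a = s ^ 2 := hs.resolve_right fun h1 => by nlinarith [sq_nonneg s]
  obtain ⟨b', rfl⟩ := evenB.two_dvd
  obtain ⟨d', rfl⟩ := evenD.two_dvd
  have hprod : (d' + b') * (d' - b') = K ^ 2 := by linarith
  have hodd : Odd (d' + b') := by
    have : Odd ((d' + b') * (d' - b')) := hprod ▸ hK.pow
    exact (Int.odd_mul.mp this).1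
  have hcop : IsCoprime (d' + b') (d' - b') := by
    refine (isCoprime_of_forall_prime (fun h0 => ?_) fun l hl l1 l2 => ?_).symm
    · rw [h0] at hodd; simp at hodd
    have l2' := hl.not_dvd_two_pow hodd l2 1
    have lK : l ∣ K := hl.dvd_of_dvd_pow (hprod ▸ l2.mul_right _)
    have ld : l ∣ 2 ^ 1 * d' := by
      rw [show 2 ^ 1 * d' = (d' + b') + (d' - b') by ring]; exact dvd_add l2 l1
    refine h.coprime.not_prime_dvd hl ?_ lK
    rw [show M = d' * (4 * d') - K * (2 * K) by linarith]
    exact dvd_sub (((hl.dvd_or_dvd ld).resolve_left l2').mul_right _) (lK.mul_right _)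
  obtain ⟨t, ht⟩ := Int.sq_of_isCoprime hcop hprod
  replace ht : d' + b' = t ^ 2 := ht.resolve_right fun h1 => by nlinarith [sq_nonneg t]
  have odd_of_sq : ∀ {n : ℤ}, Odd (n ^ 2) → Odd n := by
    intro n hn
    rw [← Int.not_even_iff_odd] at hn ⊢
    exact fun h2 => hn (h2.pow_of_ne_zero two_ne_zero)
  have os : Odd s := odd_of_sq (hs ▸ oda)
  have ot : Odd t := odd_of_sq (ht ▸ hodd)
  have ne_zero_of_odd : ∀ {n : ℤ}, Odd n → n ≠ 0 := by rintro n hn rfl; simp at hn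
  have orr : Odd r := odd_of_sq (by
    rcases hr with h1 | h1
    · exact h1 ▸ oba
    · rw [← neg_neg (r ^ 2), ← h1]; exact oba.neg)
  refine ⟨a, 2 * b', 2 * d', r, s, t, ha, hb, hd, ?_, by linarith, by linarith,
    ne_zero_of_odd orr, ne_zero_of_odd os, ne_zero_of_odd ot⟩
  rcases hr with h1 | h1
  -- The sign b + a = r² is impossible modulo 8: r, s, t, K are odd, so the left side below is 1
  -- while 56171 is 3.
  · exfalso
    have e : s ^ 2 * (2 * t ^ 2 - r ^ 2) = 56171 * K ^ 2 := by
      rw [← hs, ← ht, ← h1]; linarith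
    obtain ⟨i, hi⟩ := h8 s os
    obtain ⟨j, hj⟩ := h8 t ot
    obtain ⟨k, hk⟩ := h8 r orr
    obtain ⟨m, hm⟩ := hK8
    rw [sub_eq_iff_eq_add.mp hi, sub_eq_iff_eq_add.mp hj, sub_eq_iff_eq_add.mp hk,
      sub_eq_iff_eq_add.mp hm] at e
    ring_nf at e
    omega
  · linarith

/-- An affine point in the trivial class whose denominator is odd is twice a point in the class of
`basePoint`. -/
lemma EvenCoordinates.exists_half {u y : ℚ} {M K : ℤ} (hu : EvenCoordinates u M K) (hK : Odd K)
    (h : y ^ 2 = (u - 56169) * (u ^ 2 - 4)) : ∃ x y' h', IsOddAbscissa x ∧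
      affinePoint x y' h' + affinePoint x y' h' = affinePoint u y h := by
  obtain ⟨a, b, d, r, s, t, ha, hb, hd, hr, hs, ht, r0, s0, t0⟩ := hu.exists_signs hK
  have hK0 : (K : ℚ) ≠ 0 := by exact_mod_cast hu.pos.ne'
  have eM := hu.eq
  have r0' : (r : ℚ) ≠ 0 := by exact_mod_cast r0
  have s0' : (s : ℚ) ≠ 0 := by exact_mod_cast s0
  have t0' : (t : ℚ) ≠ 0 := by exact_mod_cast t0
  have ha' : (M : ℚ) - 56169 * K ^ 2 = a ^ 2 := by exact_mod_cast ha
  have hb' : (M : ℚ) - 2 * K ^ 2 = b ^ 2 := by exact_mod_cast hb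
  have hd' : (M : ℚ) + 2 * K ^ 2 = d ^ 2 := by exact_mod_cast hd
  have hr' : (a : ℚ) + b = -r ^ 2 := by exact_mod_cast hr
  have hs' : (a : ℚ) + d = s ^ 2 := by exact_mod_cast hs
  have ht' : (b : ℚ) + d = 2 * t ^ 2 := by exact_mod_cast ht
  have q1 : u - 56169 = (a / K : ℚ) ^ 2 := by
    rw [div_pow, eq_div_iff (by positivity), ← ha', ← eM]; ring
  have q2 : u - 2 = (b / K : ℚ) ^ 2 := by
    rw [div_pow, eq_div_iff (by positivity), ← hb', ← eM]; ring
  have q3 : u + 2 = (d / K : ℚ) ^ 2 := by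
    rw [div_pow, eq_div_iff (by positivity), ← hd', ← eM]; ring
  have p1 : (a / K : ℚ) + b / K = -(r ^ 2 / K) := by rw [← add_div, hr', neg_div]
  have p2 : (a / K : ℚ) + d / K = s ^ 2 / K := by rw [← add_div, hs']
  have p3 : (b / K : ℚ) + d / K = 2 * t ^ 2 / K := by rw [← add_div, ht']
  obtain ⟨y', h', e⟩ := _root_.exists_half h q1 q2 q3
    (by rw [p1]; exact neg_ne_zero.mpr (by positivity)) (by rw [p2]; positivity)
    (by rw [p3]; positivity)
  refine ⟨_, y', h', ⟨r * t / K, s * t / K, r * s / K, ?_, ?_, ?_⟩, e⟩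
  · have : (a / K + b / K : ℚ) * (b / K + d / K) = -(r ^ 2 / K) * (2 * t ^ 2 / K) := by
      rw [p1, p3]
    linear_combination -q2 - this
  · have : (a / K + d / K : ℚ) * (b / K + d / K) = s ^ 2 / K * (2 * t ^ 2 / K) := by
      rw [p2, p3]
    linear_combination q3 + this
  · have : (a / K + b / K : ℚ) * (a / K + d / K) = -(r ^ 2 / K) * (s ^ 2 / K) := by
      rw [p1, p2]
    linear_combination -q1 - this

/-! ### Growth of denominators and descent -/

lemma affinePoint_inj {x y x' y' : ℚ} {h : y ^ 2 = (x - 56169) * (x ^ 2 - 4)}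
    {h' : y' ^ 2 = (x' - 56169) * (x' ^ 2 - 4)} (e : affinePoint x y h = affinePoint x' y' h') :
    x = x' ∧ y = y' := by
  unfold affinePoint at e
  rwa [WeierstrassCurve.Affine.Point.some.injEq] at e

lemma double_relation {x y u v : ℚ} {h : y ^ 2 = (x - 56169) * (x ^ 2 - 4)}
    {h' : v ^ 2 = (u - 56169) * (u ^ 2 - 4)} (hx : IsOddAbscissa x)
    (e : affinePoint x y h + affinePoint x y h = affinePoint u v h') :
    u * (4 * ((x - 56169) * (x ^ 2 - 4))) =
      x ^ 4 + 8 * x ^ 2 - 1797408 * x + 50479304992 := by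
  have hy : y ≠ 0 := by
    rintro rfl
    obtain ⟨h1, h2, h3⟩ := hx.ne
    have : (x - 56169) * ((x - 2) * (x - -2)) = 0 := by linear_combination -h
    simp only [mul_eq_zero, sub_eq_zero] at this
    tauto
  have hl : (3 * x ^ 2 - 112338 * x - 4) / (2 * y) * (2 * y) = 3 * x ^ 2 - 112338 * x - 4 :=
    div_mul_cancel₀ _ (mul_ne_zero two_ne_zero hy)
  obtain ⟨_, e2⟩ := affinePoint_add_self h hy hl
  have hu := (affinePoint_inj (e2.symm.trans e)).1
  have e3 := congrArg (· ^ 2) hl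
  simp only [mul_pow] at e3
  rw [← hu]
  linear_combination e3 - 4 * ((3 * x ^ 2 - 112338 * x - 4) / (2 * y)) ^ 2 * h

/-- The point lies in the class of `basePoint` and its abscissa has denominator `w²`. -/
def HasOddDenominator (Q : pairCurve.Point) (w : ℤ) : Prop :=
  ∃ x y h X, Q = affinePoint x y h ∧ IsOddAbscissa x ∧ OddCoordinates x X w

/-- The point is nonzero, lies in the trivial class and its abscissa is `M / K²` in lowest terms. -/
def HasEvenCoordinates (P : pairCurve.Point) (M K : ℤ) : Prop :=
  ∃ x y h, P = affinePoint x y h ∧ IsEvenAbscissa x ∧ EvenCoordinates x M K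

lemma HasOddDenominator.unique {Q : pairCurve.Point} {w w' : ℤ} (h : HasOddDenominator Q w)
    (h' : HasOddDenominator Q w') : w = w' := by
  obtain ⟨x, y, hx, X, e, -, hc⟩ := h
  obtain ⟨x', y', hx', X', e', -, hc'⟩ := h'
  exact hc.unique hc' (.inl (affinePoint_inj (e.symm.trans e')).1)

lemma HasOddDenominator.neg {Q : pairCurve.Point} {w : ℤ} (h : HasOddDenominator Q w) :
    HasOddDenominator (-Q) w := by
  obtain ⟨x, y, hx, X, rfl, ho, hc⟩ := h
  exact ⟨x, -y, _, X, neg_affinePoint hx, ho, hc⟩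

lemma HasOddDenominator.neighbours {Q : pairCurve.Point} {w : ℤ} (h : HasOddDenominator Q w)
    (hw : w ≠ 1) : ∃ M K M' K' : ℤ, HasEvenCoordinates (Q + basePoint) M K ∧
      HasEvenCoordinates (Q - basePoint) M' K' ∧ (Odd K ∨ Odd K') ∧
      3154844224 * w ^ 4 ≤ M * M' ∧ M * M' ≤ 3155068900 * w ^ 4 := by
  obtain ⟨x, y, hx, X, rfl, ho, hc⟩ := h
  have hX : X ≠ 0 := fun h0 => hw (hc.eq_one_of_eq_zero h0)
  obtain ⟨u, v, u', v', hu, hv, e1, e2, hs, hp, he, -⟩ :=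
    affinePoint_add_sub_basePoint hx (hc.ne_zero_iff.mpr hX)
  obtain ⟨eu, ev⟩ := he ho
  obtain ⟨M, K, hMK⟩ := eu.exists_coordinates
  obtain ⟨M', K', hMK'⟩ := ev.exists_coordinates
  obtain ⟨hM, hK⟩ := hc.neighbours hMK hMK' hX hs hp
  refine ⟨M, K, M', K', ⟨u, u', hu, e1, eu, hMK⟩, ⟨v, v', hv, e2, ev, hMK'⟩, hK, ?_, ?_⟩ <;>
  -- Since |X| ≤ 2w², the bounds are 3154956562 ∓ 2 · 56169.
  · rw [hM]
    obtain ⟨b1, b2⟩ := hc.bounds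
    have := sq_nonneg w
    nlinarith

lemma HasEvenCoordinates.neighbours {P : pairCurve.Point} {M K : ℤ}
    (h : HasEvenCoordinates P M K) : ∃ w w' : ℤ, HasOddDenominator (P + basePoint) w ∧
      HasOddDenominator (P - basePoint) w' ∧ M ≤ 2 * (w * w') := by
  obtain ⟨x, y, hx, rfl, ho, hc⟩ := h
  have hx0 : x ≠ 0 := by have := ho.le; positivity
  obtain ⟨u, v, u', v', hu, hv, e1, e2, hs, hp, -, he⟩ := affinePoint_add_sub_basePoint hx hx0
  obtain ⟨eu, ev⟩ := he ho
  obtain ⟨X, w, hw⟩ := eu.exists_coordinates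
  obtain ⟨X', w', hw'⟩ := ev.exists_coordinates
  exact ⟨w, w', ⟨u, u', hu, X, e1, eu, hw⟩, ⟨v, v', hv, X', e2, ev, hw'⟩,
    hc.neighbours hw hw' hs hp⟩

lemma HasOddDenominator.pos {Q : pairCurve.Point} {w : ℤ} (h : HasOddDenominator Q w) :
    0 < w := by
  obtain ⟨x, y, hx, X, rfl, ho, hc⟩ := h
  exact hc.pos

lemma HasEvenCoordinates.le {P : pairCurve.Point} {M K : ℤ} (h : HasEvenCoordinates P M K) :
    56169 ≤ M := by
  obtain ⟨x, y, hx, rfl, ho, hc⟩ := h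
  exact hc.le

lemma isOddAbscissa_zero : IsOddAbscissa 0 := ⟨1, 1, 237, by norm_num, by norm_num, by norm_num⟩

lemma hasOddDenominator_basePoint : HasOddDenominator basePoint 1 :=
  ⟨0, 474, _, 0, rfl, isOddAbscissa_zero,
    ⟨by norm_num, by norm_num, by norm_num, by norm_num, by norm_num,
      1, 1, 237, by norm_num, by norm_num, by norm_num, by norm_num, by norm_num⟩⟩

lemma hasEvenCoordinates_double_basePoint :
    HasEvenCoordinates (basePoint + basePoint) 3154956562 237 := by
  -- The tangent at (0, 474) has slope -4 / 948 = -1 / 237.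
  obtain ⟨h, e⟩ := affinePoint_add_self (x := 0) (y := 474) (l := -(1 / 237)) (by norm_num)
    (by norm_num) (by norm_num)
  refine ⟨_, _, h, e, ⟨56168 / 237, 56170 / 237, 1 / 237, by norm_num, by norm_num, by norm_num⟩,
    ⟨by norm_num, by norm_num, ?_, 56168, 56170, 1, by norm_num, by norm_num, by norm_num⟩⟩
  rw [Int.isCoprime_iff_gcd_eq_one]
  norm_num

/-- The denominators increase along the odd multiples of `basePoint`. -/
lemma exists_denominators_lt (n : ℕ) : ∃ w w' : ℤ,
    HasOddDenominator ((2 * n + 1 : ℤ) • basePoint) w ∧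
    HasOddDenominator ((2 * (n + 1 : ℕ) + 1 : ℤ) • basePoint) w' ∧ w < w' := by
  induction n with
  | zero =>
    obtain ⟨w, w', h1, h2, hM⟩ := hasEvenCoordinates_double_basePoint.neighbours
    refine ⟨1, w, by simpa using hasOddDenominator_basePoint, ?_, ?_⟩
    · convert h1 using 1
      push_cast
      module
    · rw [add_sub_cancel_right] at h2
      rw [h2.unique hasOddDenominator_basePoint] at hM
      linarith
  | succ n ih =>
    obtain ⟨w, w', h1, h2, hlt⟩ := ih
    have hw := h1.pos
    obtain ⟨M, K, M', K', hM, hM', -, hb, -⟩ := h2.neighbours (by linarith)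
    obtain ⟨r, r', hr, hr', hr2⟩ := hM.neighbours
    obtain ⟨s, s', hs, hs', hs2⟩ := hM'.neighbours
    refine ⟨w', r, h2, ?_, ?_⟩
    · convert hr using 1
      push_cast
      module
    · rw [add_sub_cancel_right] at hr'
      rw [sub_add_cancel] at hs
      obtain rfl := hr'.unique h2
      obtain rfl := hs.unique h2
      have e : s' = w := by
        refine hs'.unique ?_
        convert h1 using 1
        push_cast
        module
      subst e
      have hr0 := hr.pos
      have hs0 := hs.pos
      -- If r ≤ s, then rs' ≤ s², and the two upper bounds give MM' ≤ 4s⁴, far below the lower bound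
      -- 3154844224s⁴.
      by_contra hcon
      have hle := not_lt.mp hcon
      have h3 : M * M' ≤ 2 * (r * s) * (2 * (s * s')) :=
        mul_le_mul hr2 hs2 (by linarith [hM'.le]) (by positivity)
      have h4 : r * s' ≤ s * s := mul_le_mul hle hlt.le hw.le hs0.le
      have h5 : 2 * (r * s) * (2 * (s * s')) ≤ 4 * s ^ 4 := by
        have : 0 ≤ s ^ 2 := sq_nonneg s
        nlinarith
      have : 0 < s ^ 4 := by positivity
      linarith

lemma exists_strictMono_denominators : ∃ f : ℕ → ℤ, StrictMono f ∧
    ∀ n : ℕ, HasOddDenominator ((2 * n + 1 : ℤ) • basePoint) (f n) := by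
  choose f g hf hg hlt using exists_denominators_lt
  refine ⟨f, strictMono_nat_of_lt_succ fun n => ?_, hf⟩
  rw [(hf (n + 1)).unique (hg n)]
  exact hlt n

/-- Every point in the class of `basePoint` is an odd multiple of it. -/
lemma HasOddDenominator.exists_eq_smul (N : ℕ) : ∀ {Q : pairCurve.Point} {w : ℤ},
    HasOddDenominator Q w → w ≤ N → ∃ n : ℤ, Q = (2 * n + 1) • basePoint := by
  induction N with
  | zero => intro Q w h hw; have := h.pos; push_cast at hw; omega
  | succ N ih =>
    intro Q w h hwN
    by_cases hw : w = 1
    · obtain ⟨x, y, hx, X, rfl, ho, hc⟩ := h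
      have hX := hc.eq_zero_of_eq_one hw
      obtain rfl : x = 0 := by
        by_contra h0
        exact hc.ne_zero_iff.mp h0 hX
      rcases affinePoint_eq_or_eq_neg hx (y' := 474) (by norm_num) with e | e
      · exact ⟨0, by rw [e, basePoint]; simp⟩
      · exact ⟨-1, by rw [e, basePoint]; simp⟩
    have hw0 := h.pos
    obtain ⟨M, K, M', K', hM, hM', hK, -, hb⟩ := h.neighbours hw
    -- The other numerator is at least 56169, so the upper bound on MM' bounds M by a multiple of
    -- w⁴; the lower bound on M by a multiple of r⁸ then excludes r ≥ w.
    have half : ∀ {P : pairCurve.Point} {M K : ℤ}, HasEvenCoordinates P M K → Odd K →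
        M * 56169 ≤ 3155068900 * w ^ 4 → ∃ n : ℤ, P = (2 * (2 * n + 1)) • basePoint := by
      rintro P M K ⟨u, v, hu, rfl, -, hc⟩ hK hle
      obtain ⟨x, y, hx, ho, e⟩ := hc.exists_half hK hu
      obtain ⟨X, r, hr⟩ := ho.exists_coordinates
      have hr0 := hr.pos
      have h1 := hr.le_of_double hc (double_relation ho e)
      have hlt : r < w := by
        by_contra hcon
        have h2 : w ^ 4 ≤ r ^ 4 := pow_le_pow_left₀ hw0.le (not_lt.mp hcon) 4
        have h3 : 0 < r ^ 4 := by positivity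
        nlinarith
      obtain ⟨n, hn⟩ := ih (Q := affinePoint x y hx) ⟨x, y, hx, X, rfl, ho, hr⟩
        (by push_cast at hwN; omega)
      exact ⟨n, by rw [← e, hn]; module⟩
    have l1 := hM.le
    have l2 := hM'.le
    rcases hK with hK | hK
    · obtain ⟨n, hn⟩ := half hM hK (by nlinarith)
      exact ⟨2 * n, by rw [eq_sub_of_add_eq hn]; module⟩
    · obtain ⟨n, hn⟩ := half hM' hK (by nlinarith)
      exact ⟨2 * n + 1, by rw [eq_add_of_sub_eq hn]; module⟩

/-- Two points in the class of `basePoint` with opposite abscissae have abscissa zero. -/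
lemma eq_zero_of_isOddAbscissa_neg {x y y' : ℚ} (h : y ^ 2 = (x - 56169) * (x ^ 2 - 4))
    (h' : y' ^ 2 = (-x - 56169) * ((-x) ^ 2 - 4)) (ho : IsOddAbscissa x)
    (ho' : IsOddAbscissa (-x)) : x = 0 := by
  obtain ⟨X, w, hc⟩ := ho.exists_coordinates
  obtain ⟨X', w', hc'⟩ := ho'.exists_coordinates
  obtain rfl := hc.unique hc' (.inr (neg_neg x).symm)
  have hQ : HasOddDenominator (affinePoint x y h) w := ⟨x, y, h, X, rfl, ho, hc⟩
  have hQ' : HasOddDenominator (affinePoint (-x) y' h') w := ⟨-x, y', h', X', rfl, ho', hc'⟩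
  obtain ⟨f, hf, hfw⟩ := exists_strictMono_denominators
  have key : ∀ {Q : pairCurve.Point}, HasOddDenominator Q w →
      ∃ n : ℕ, f n = w ∧ (Q = (2 * n + 1 : ℤ) • basePoint ∨ Q = -((2 * n + 1 : ℤ) • basePoint)) := by
    intro Q hQ
    obtain ⟨n, hn⟩ := hQ.exists_eq_smul w.toNat (Int.self_le_toNat w)
    rcases le_or_gt 0 n with h0 | h0
    · lift n to ℕ using h0
      exact ⟨n, ((hn ▸ hQ).unique (hfw n)).symm, .inl hn⟩
    -- For n < 0 one has 2n + 1 = -(2m + 1) with m = -n - 1 ≥ 0.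
    · obtain ⟨m, hm⟩ := Int.eq_ofNat_of_zero_le (show 0 ≤ -n - 1 by omega)
      have e : Q = -((2 * m + 1 : ℤ) • basePoint) := by
        rw [hn, ← hm]; module
      refine ⟨m, (hfw m).unique ?_, .inr e⟩
      have := hQ.neg
      rwa [e, neg_neg] at this
  obtain ⟨n, hn, e⟩ := key hQ
  obtain ⟨m, hm, e'⟩ := key hQ'
  obtain rfl := hf.injective (hn.trans hm.symm)
  have : affinePoint x y h = affinePoint (-x) y' h' ∨
      affinePoint x y h = -affinePoint (-x) y' h' := by
    rcases e with e | e <;> rcases e' with e' | e' <;> rw [e, e'] <;> simp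
  have hx : x = -x := by
    rcases this with e | e
    · exact (affinePoint_inj e).1
    · rw [neg_affinePoint] at e
      exact (affinePoint_inj e).1
  linarith

/-! ### From the hyperelliptic curve to the elliptic curve -/

lemma Nat.Prime.not_dvd_sq_add_sq {p : ℕ} (hp : p.Prime) (h4 : p % 4 = 3) {m n : ℤ}
    (h : IsCoprime m n) : ¬ (p : ℤ) ∣ m ^ 2 + n ^ 2 := by
  intro hd
  have := Fact.mk hp
  have hz : (m : ZMod p) ^ 2 = -(n : ZMod p) ^ 2 := by
    rw [← add_eq_zero_iff_eq_neg]
    exact_mod_cast (ZMod.intCast_zmod_eq_zero_iff_dvd _ p).mpr hd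
  by_cases hn : (n : ZMod p) = 0
  · rw [hn] at hz
    have hm : (m : ZMod p) = 0 := by simpa using hz
    exact h.not_prime_dvd (Nat.prime_iff_prime_int.mp hp)
      ((ZMod.intCast_zmod_eq_zero_iff_dvd _ p).mp hm) ((ZMod.intCast_zmod_eq_zero_iff_dvd _ p).mp hn)
  · exact ZMod.mod_four_ne_three_of_sq_eq_neg_sq' hn hz h4

/-- A common prime of the factors is odd and divides both W and 56169S, which is excluded. The
factors are thus squares up to sign, and their positive sum 2W² fixes the signs. -/
lemma exists_sq_of_mul_eq_sq {W S Y : ℤ} (hW : Odd W) (hS : Even S)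
    (hWS : ∀ l : ℤ, Prime l → ¬ l ∣ 2 → l ∣ W → l ∣ 56169 * S → False)
    (h : (W ^ 2 + 56169 * S) * (W ^ 2 - 56169 * S) = Y ^ 2) :
    ∃ a b : ℤ, W ^ 2 + 56169 * S = a ^ 2 ∧ W ^ 2 - 56169 * S = b ^ 2 := by
  have hodd : Odd (W ^ 2 - 56169 * S) := hW.pow.sub_even (hS.mul_left _)
  have hc : IsCoprime (W ^ 2 + 56169 * S) (W ^ 2 - 56169 * S) := by
    refine isCoprime_of_forall_prime (fun h0 => by rw [h0] at hodd; simp at hodd)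
      fun l hl l1 l2 => ?_
    have h2 := hl.not_dvd_two_pow hodd l2 1
    rw [pow_one] at h2
    have e1 : l ∣ 2 * W ^ 2 := by
      have := dvd_add l1 l2
      rwa [show W ^ 2 + 56169 * S + (W ^ 2 - 56169 * S) = 2 * W ^ 2 by ring] at this
    have lW := (hl.dvd_or_dvd e1).resolve_left h2
    exact hWS l hl h2 (hl.dvd_of_dvd_pow lW) ((dvd_add_right lW).mp l1)
  have hW0 : 0 < W ^ 2 := by
    have : W ≠ 0 := by rintro rfl; simp at hW
    positivity
  have aux : ∀ {U V : ℤ}, IsCoprime U V → U * V = Y ^ 2 → 0 < U + V → ∃ a, U = a ^ 2 := by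
    intro U V hUV hprod hsum
    obtain ⟨a, ha | ha⟩ := Int.sq_of_isCoprime hUV hprod
    · exact ⟨a, ha⟩
    · refine ⟨0, ?_⟩
      nlinarith [sq_nonneg a, sq_nonneg Y]
  obtain ⟨a, ha⟩ := aux hc h (by linarith)
  obtain ⟨b, hb⟩ := aux hc.symm (by linarith) (by linarith)
  exact ⟨a, b, ha, hb⟩

lemma not_prime_dvd_sq_add_sq {m n l : ℤ} (h : IsCoprime m n) (hl : Prime l) (h2 : ¬ l ∣ 2)
    (hW : l ∣ m ^ 2 + n ^ 2) : ¬ l ∣ 56169 * (2 * (m * n * (m ^ 2 - n ^ 2))) := by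
  have key : l ∣ m ∨ l ∣ n → False := by
    rintro (h3 | h3)
    · exact h.not_prime_dvd hl h3
        (hl.dvd_of_dvd_pow ((dvd_add_right (dvd_pow h3 two_ne_zero)).mp hW))
    · exact h.not_prime_dvd hl
        (hl.dvd_of_dvd_pow ((dvd_add_left (dvd_pow h3 two_ne_zero)).mp hW)) h3
  intro hd
  rcases hl.dvd_or_dvd hd with h3 | h3
  · have h4 : l ∣ 3 ^ 2 * 79 ^ 2 := by norm_num; exact h3
    have aux : ∀ p : ℕ, p.Prime → p % 4 = 3 → l ∣ (p : ℤ) ^ 2 → False := by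
      intro p hp h5 h6
      have h7 := (hl.dvd_prime_iff_associated (Nat.prime_iff_prime_int.mp hp)).mp
        (hl.dvd_of_dvd_pow h6)
      exact hp.not_dvd_sq_add_sq h5 h (h7.symm.dvd.trans hW)
    rcases hl.dvd_or_dvd h4 with h5 | h5
    · exact aux 3 (by norm_num) (by norm_num) h5
    · exact aux 79 (by norm_num) (by norm_num) h5
  · rcases hl.dvd_or_dvd ((hl.dvd_or_dvd h3).resolve_left h2) with h4 | h4
    · exact key (hl.dvd_or_dvd h4)
    · have h5 : l ∣ 2 * m ^ 2 := by
        have := dvd_add hW h4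
        rwa [show m ^ 2 + n ^ 2 + (m ^ 2 - n ^ 2) = 2 * m ^ 2 by ring] at this
      exact key (.inl (hl.dvd_of_dvd_pow ((hl.dvd_or_dvd h5).resolve_left h2)))

/-- On a rational point of the curve, both factors of `f` are squares. -/
lemma exists_sq_factors {m n Y : ℤ} (h : IsCoprime m n)
    (hY : Y ^ 2 = (m ^ 2 + n ^ 2) ^ 4 - 56169 ^ 2 * (2 * (m * n * (m ^ 2 - n ^ 2))) ^ 2) :
    ∃ a b : ℤ, (m ^ 2 + n ^ 2) ^ 2 + 56169 * (2 * (m * n * (m ^ 2 - n ^ 2))) = a ^ 2 ∧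
      (m ^ 2 + n ^ 2) ^ 2 - 56169 * (2 * (m * n * (m ^ 2 - n ^ 2))) = b ^ 2 := by
  by_cases hodd : Odd (m ^ 2 + n ^ 2)
  · exact exists_sq_of_mul_eq_sq (Y := Y) hodd (even_two_mul _)
      (fun l hl h2 hW => not_prime_dvd_sq_add_sq h hl h2 hW) (by linarith)
  · have hmn : Odd m ∧ Odd n := by
      rw [Int.not_odd_iff_even, Int.even_add, Int.even_pow' two_ne_zero,
        Int.even_pow' two_ne_zero] at hodd
      rw [← Int.not_even_iff_odd, ← Int.not_even_iff_odd]
      by_contra hcon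
      have : Even m ∧ Even n := by tauto
      exact h.not_prime_dvd Int.prime_two this.1.two_dvd this.2.two_dvd
    obtain ⟨i, hi⟩ := Int.eight_dvd_sq_sub_one_of_odd hmn.1
    obtain ⟨j, hj⟩ := Int.eight_dvd_sq_sub_one_of_odd hmn.2
    -- For m, n odd, the sum is twice an odd number and the difference is divisible by 8; both
    -- factors are 4 times those of the reduced problem.
    have eW : m ^ 2 + n ^ 2 = 2 * (4 * (i + j) + 1) := by linarith
    have eD : m ^ 2 - n ^ 2 = 2 * (4 * (i - j)) := by linarith
    obtain ⟨Z, rfl⟩ : (4 : ℤ) ∣ Y := by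
      rw [← Int.pow_dvd_pow_iff two_ne_zero, hY, eW, eD]
      exact ⟨(4 * (i + j) + 1) ^ 4 - 56169 ^ 2 * (m * n * (4 * (i - j))) ^ 2, by ring⟩
    obtain ⟨a, b, ha, hb⟩ := exists_sq_of_mul_eq_sq (W := 4 * (i + j) + 1)
      (S := m * n * (4 * (i - j))) (Y := Z) ⟨2 * (i + j), by ring⟩
      ((Even.mul_right ⟨2, by norm_num⟩ _).mul_left _) (fun l hl h2 h3 h4 => by
        refine not_prime_dvd_sq_add_sq h hl h2 (eW ▸ h3.mul_left 2) ?_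
        rw [eD]
        refine (h4.mul_left 4).trans (dvd_of_eq ?_)
        ring)
      (by rw [eW, eD] at hY; linarith)
    refine ⟨2 * a, 2 * b, ?_, ?_⟩
    · rw [eW, eD]; linear_combination 4 * ha
    · rw [eW, eD]; linear_combination 4 * hb

lemma eq_zero_of_sq_eq {m n Y : ℤ} (h : IsCoprime m n)
    (hY : Y ^ 2 = (m ^ 2 + n ^ 2) ^ 4 - 56169 ^ 2 * (2 * (m * n * (m ^ 2 - n ^ 2))) ^ 2) :
    m * n * (m ^ 2 - n ^ 2) = 0 := by
  obtain ⟨a, b, ha, hb⟩ := exists_sq_factors h hY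
  have hW : m ^ 2 + n ^ 2 ≠ 0 := by
    intro h0
    have hm : m = 0 := by nlinarith [sq_nonneg m, sq_nonneg n]
    have hn : n = 0 := by nlinarith [sq_nonneg m, sq_nonneg n]
    rw [hm, hn, isCoprime_zero_left] at h
    exact not_isUnit_zero h
  obtain ⟨W, hWe⟩ : ∃ W : ℚ, W = m ^ 2 + n ^ 2 := ⟨_, rfl⟩
  obtain ⟨S, hSe⟩ : ∃ S : ℚ, S = 2 * (m * n * (m ^ 2 - n ^ 2)) := ⟨_, rfl⟩
  have hW0 : W ≠ 0 := by rw [hWe]; exact_mod_cast hW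
  have qa : W ^ 2 + 56169 * S = (a : ℚ) ^ 2 := by rw [hWe, hSe]; exact_mod_cast ha
  have qb : W ^ 2 - 56169 * S = (b : ℚ) ^ 2 := by rw [hWe, hSe]; exact_mod_cast hb
  have qc : W ^ 2 + 2 * S = ((m : ℚ) ^ 2 - n ^ 2 + 2 * m * n) ^ 2 := by rw [hWe, hSe]; ring
  have qd : W ^ 2 - 2 * S = ((m : ℚ) ^ 2 - n ^ 2 - 2 * m * n) ^ 2 := by rw [hWe, hSe]; ring
  -- With this x, 2 ∓ x and 56169 ∓ x become the squares `qb`, `qa`, `qd`, `qc` up to the factors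
  -- 2/W² and 56169/W². Changing the sign of S changes that of x, so -x qualifies too.
  obtain ⟨x, hx⟩ : ∃ x : ℚ, x = 112338 * S / W ^ 2 := ⟨_, rfl⟩
  have hx' : x * W ^ 2 = 112338 * S := by rw [hx]; field_simp
  have ho : ∀ {x c d e : ℚ}, (2 - x) * W ^ 2 = 2 * c ^ 2 → (2 + x) * W ^ 2 = 2 * d ^ 2 →
      (56169 - x) * W ^ 2 = 56169 * e ^ 2 → IsOddAbscissa x ∧
        ∃ y : ℚ, y ^ 2 = (x - 56169) * (x ^ 2 - 4) := by
    intro x c d e h1 h2 h3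
    have e1 : 2 - x = 2 * (c / W) ^ 2 := by field_simp; linarith
    have e2 : 2 + x = 2 * (d / W) ^ 2 := by field_simp; linarith
    have e3 : 56169 - x = (237 * (e / W)) ^ 2 := by field_simp; linarith
    refine ⟨⟨_, _, _, e1, e2, e3⟩, 2 * (c / W) * (d / W) * (237 * (e / W)), ?_⟩
    rw [show (x - 56169) * (x ^ 2 - 4) = (56169 - x) * ((2 - x) * (2 + x)) by ring, e1, e2, e3]
    ring
  obtain ⟨o1, y, hy⟩ := ho (x := x) (c := b) (d := a)
    (e := (m : ℚ) ^ 2 - n ^ 2 - 2 * m * n) (by linarith) (by linarith) (by linarith)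
  obtain ⟨o2, y', hy'⟩ := ho (x := -x) (c := a) (d := b)
    (e := (m : ℚ) ^ 2 - n ^ 2 + 2 * m * n) (by linarith) (by linarith) (by linarith)
  have hx0 := eq_zero_of_isOddAbscissa_neg hy hy' o1 o2
  have hS : S = 0 := by rw [hx0] at hx'; linarith
  rw [hSe] at hS
  have : (2 * (m * n * (m ^ 2 - n ^ 2)) : ℤ) = 0 := by exact_mod_cast hS
  omega

lemma mul_eq_zero_of_sq_eq {x y z : ℚ}
    (h : y ^ 2 = (x ^ 2 + z ^ 2) ^ 4 - 56169 ^ 2 * (2 * (x * z * (x ^ 2 - z ^ 2))) ^ 2) :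
    x = 0 ∨ z = 0 ∨ x = z ∨ x = -z := by
  by_cases hz : z = 0
  · exact .inr (.inl hz)
  obtain ⟨q, hq⟩ : ∃ q : ℚ, x = q * z := ⟨x / z, (div_mul_cancel₀ _ hz).symm⟩
  have hd : (q.den : ℚ) ≠ 0 := by exact_mod_cast q.den_ne_zero
  have hn : (q.num : ℚ) = q * q.den := (Rat.mul_den_eq_num q).symm
  have hcop : IsCoprime q.num q.den := by
    rw [Int.isCoprime_iff_gcd_eq_one]; exact q.reduced
  -- The rescaled ordinate has an integral square, hence is itself an integer.
  have hY : (y * q.den ^ 4 / z ^ 4) ^ 2 = (((q.num ^ 2 + (q.den : ℤ) ^ 2) ^ 4 -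
      56169 ^ 2 * (2 * (q.num * q.den * (q.num ^ 2 - (q.den : ℤ) ^ 2))) ^ 2 : ℤ) : ℚ) := by
    push_cast
    rw [hn, div_pow, mul_pow, h, hq, div_eq_iff (by positivity)]
    ring
  obtain ⟨Y, hYe⟩ := exists_int_eq_of_sq_eq hY
  rw [hYe] at hY
  have h0 := eq_zero_of_sq_eq hcop (Y := Y) (by exact_mod_cast hY)
  have h1 : (q.num : ℚ) * q.den * ((q.num : ℚ) ^ 2 - q.den ^ 2) = 0 := by exact_mod_cast h0
  rw [hn] at h1
  have h2 : q * ((q - 1) * (q + 1)) = 0 := by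
    have : (q.den : ℚ) ^ 4 * (q * ((q - 1) * (q + 1))) = 0 := by linear_combination h1
    exact (mul_eq_zero.mp this).resolve_left (by positivity)
  rcases mul_eq_zero.mp h2 with h3 | h3
  · exact .inl (by rw [hq, h3, zero_mul])
  · rcases mul_eq_zero.mp h3 with h4 | h4
    · exact .inr (.inr (.inl (by rw [hq, sub_eq_zero.mp h4, one_mul])))
    · exact .inr (.inr (.inr (by rw [hq, eq_neg_of_add_eq_zero_left h4]; ring)))

/-! ### The model and its eight points -/

lemma curvePoly_natDegree : (curvePoly 237).natDegree = 8 := by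
  unfold curvePoly
  compute_degree!

lemma curvePoly_coeff (n : ℕ) : (curvePoly 237).coeff n = (if n = 8 then 1 else 0) +
    (4 - 4 * (237 : ℚ) ^ 4) * (if n = 6 then 1 else 0) +
    (8 * (237 : ℚ) ^ 4 + 6) * (if n = 4 then 1 else 0) +
    (4 - 4 * (237 : ℚ) ^ 4) * (if n = 2 then 1 else 0) + (if n = 0 then 1 else 0) := by
  simp only [curvePoly, coeff_add, coeff_C_mul, coeff_X_pow, coeff_one, Int.cast_ofNat]

lemma curvePoly_monic : (curvePoly 237).Monic := by
  rw [Monic, leadingCoeff, curvePoly_natDegree]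
  simp [curvePoly_coeff]

lemma curvePoly_separable : (curvePoly 237).Separable := by
  have hf : curvePoly 237 = X ^ 8 - 12619826240 * X ^ 6 + 25239652494 * X ^ 4
      - 12619826240 * X ^ 2 + 1 := by
    unfold curvePoly
    rw [show (4 - 4 * ((237 : ℤ) : ℚ) ^ 4) = -12619826240 by norm_num,
      show (8 * ((237 : ℤ) : ℚ) ^ 4 + 6) = 25239652494 by norm_num]
    simp only [map_neg, map_ofNat]
    ring
  have hf' : derivative (curvePoly 237) = 8 * X ^ 7 - 75718957440 * X ^ 5
      + 100958609976 * X ^ 3 - 25239652480 * X := by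
    rw [hf]
    simp only [derivative_add, derivative_sub, derivative_mul, derivative_X_pow,
      derivative_one, derivative_ofNat, Nat.cast_ofNat, map_ofNat]
    ring
  -- With f = g(X²), U and V are Bézout cofactors of g and g' taken at X². As f' = 2X · g'(X²), the
  -- combination of f and f' is a constant times X.
  obtain ⟨U, hU⟩ : ∃ U : ℚ[X], U = -19907502194808507072 + 59722505631628639520 * X ^ 2
    - 6309913148 * X ^ 4 := ⟨_, rfl⟩
  obtain ⟨V, hV⟩ : ∃ V : ℚ[X], V = -52056783240 + 19907501991313808857 * X ^ 2
    - 19907501877735372600 * X ^ 4 + 1577478287 * X ^ 6 := ⟨_, rfl⟩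
  have key : 2 * X * U * curvePoly 237 + V * derivative (curvePoly 237) =
      2 * 637040056907335710528 * X := by
    rw [hf', hf, hU, hV]; ring
  -- The constant term of f is 1, so X is invertible modulo f and the leftover factor X can be
  -- removed.
  obtain ⟨R, hR⟩ : ∃ R : ℚ[X], curvePoly 237 = 1 + X * R :=
    ⟨X ^ 7 - 12619826240 * X ^ 5 + 25239652494 * X ^ 3 - 12619826240 * X, by rw [hf]; ring⟩
  have hC : (C (1 / 1274080113814671421056) : ℚ[X]) * 1274080113814671421056 = 1 := by
    rw [← map_ofNat C, ← C_mul]; norm_num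
  refine ⟨C (1 / 1274080113814671421056) * (1274080113814671421056 - 2 * X * R * U),
    -C (1 / 1274080113814671421056) * (R * V), ?_⟩
  linear_combination (-C (1 / 1274080113814671421056) * R) * key + hC +
    C (1 / 1274080113814671421056) * 1274080113814671421056 * hR

/-- The terms in 237⁴ combine to minus a perfect square, so f is a difference of two squares. -/
lemma homogenizedEval_curvePoly (x z : ℚ) : homogenizedEval 3 (curvePoly 237) x z =
    (x ^ 2 + z ^ 2) ^ 4 - 56169 ^ 2 * (2 * (x * z * (x ^ 2 - z ^ 2))) ^ 2 := by
  simp [homogenizedEval, Finset.sum_range_succ, curvePoly_coeff]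
  ring

lemma WeightedPlane.mk_eq_mk_iff {g : ℕ} {x y z x' y' z' : ℚ} {h : (x, y, z) ≠ (0, 0, 0)}
    {h' : (x', y', z') ≠ (0, 0, 0)} : WeightedPlane.mk g x y z h = WeightedPlane.mk g x' y' z' h' ↔
      ∃ t : ℚ, t ≠ 0 ∧ x' = t * x ∧ y' = t ^ (g + 1) * y ∧ z' = t * z := by
  unfold WeightedPlane.mk
  exact Quotient.eq (r := weightedSetoid g)

lemma exists_eq_of_sq_eq {x y z : ℚ} (h0 : (x, y, z) ≠ (0, 0, 0))
    (h : y ^ 2 = homogenizedEval 3 (curvePoly 237) x z) :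
    ∃ t : ℚ, t ≠ 0 ∧ ∃ v ∈ ([(1, 4, 1), (1, -4, 1), (-1, 4, 1), (-1, -4, 1), (0, 1, 1), (0, -1, 1),
      (1, 1, 0), (1, -1, 0)] : List (ℚ × ℚ × ℚ)),
      x = t * v.1 ∧ y = t ^ 4 * v.2.1 ∧ z = t * v.2.2 := by
  rw [homogenizedEval_curvePoly] at h
  have hxz : ¬ (x = 0 ∧ z = 0) := by
    rintro ⟨rfl, rfl⟩
    have : y = 0 := by simpa using h
    exact h0 (by rw [this])
  rcases mul_eq_zero_of_sq_eq h with rfl | rfl | rfl | rfl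
  · have hz : z ≠ 0 := fun hz => hxz ⟨rfl, hz⟩
    have : y ^ 2 = (z ^ 4) ^ 2 := by rw [h]; ring
    rcases sq_eq_sq_iff_eq_or_eq_neg.mp this with e | e <;>
      exact ⟨z, hz, by simp [e]⟩
  · have hz : x ≠ 0 := fun hx => hxz ⟨hx, rfl⟩
    have : y ^ 2 = (x ^ 4) ^ 2 := by rw [h]; ring
    rcases sq_eq_sq_iff_eq_or_eq_neg.mp this with e | e <;>
      exact ⟨x, hz, by simp [e, hz]⟩
  · have hz : x ≠ 0 := fun hx => hxz ⟨hx, hx⟩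
    have : y ^ 2 = (x ^ 4 * 4) ^ 2 := by rw [h]; ring
    rcases sq_eq_sq_iff_eq_or_eq_neg.mp this with e | e <;>
      exact ⟨x, hz, by simp [e, hz]⟩
  · have hz : z ≠ 0 := fun hx => hxz ⟨by rw [hx, neg_zero], hx⟩
    have : y ^ 2 = (z ^ 4 * 4) ^ 2 := by rw [h]; ring
    rcases sq_eq_sq_iff_eq_or_eq_neg.mp this with e | e <;>
      exact ⟨z, hz, by simp [e, hz]⟩

lemma hyperellipticPoints_curvePoly : hyperellipticPoints 3 (curvePoly 237) =
      {WeightedPlane.mk 3 1 4 1 (by simp), WeightedPlane.mk 3 1 (-4) 1 (by simp),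
        WeightedPlane.mk 3 (-1) 4 1 (by simp), WeightedPlane.mk 3 (-1) (-4) 1 (by simp),
        WeightedPlane.mk 3 0 1 1 (by simp), WeightedPlane.mk 3 0 (-1) 1 (by simp),
        WeightedPlane.mk 3 1 1 0 (by simp), WeightedPlane.mk 3 1 (-1) 0 (by simp)} := by
  ext P
  constructor
  · rintro ⟨x, y, z, h, rfl, he⟩
    obtain ⟨t, ht, ⟨a, b, d⟩, hv, h1⟩ := exists_eq_of_sq_eq h he
    have key : ∀ h', WeightedPlane.mk 3 x y z h = WeightedPlane.mk 3 a b d h' := fun h' =>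
      (WeightedPlane.mk_eq_mk_iff.mpr ⟨t, ht, h1⟩).symm
    simp only [List.mem_cons, Prod.mk.injEq, List.not_mem_nil, or_false] at hv
    rcases hv with ⟨rfl, rfl, rfl⟩ | ⟨rfl, rfl, rfl⟩ | ⟨rfl, rfl, rfl⟩ | ⟨rfl, rfl, rfl⟩ |
      ⟨rfl, rfl, rfl⟩ | ⟨rfl, rfl, rfl⟩ | ⟨rfl, rfl, rfl⟩ | ⟨rfl, rfl, rfl⟩ <;>
    · rw [key (by simp)]
      simp only [Set.mem_insert_iff, Set.mem_singleton_iff, true_or, or_true]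
  · simp only [Set.mem_insert_iff, Set.mem_singleton_iff]
    rintro (rfl | rfl | rfl | rfl | rfl | rfl | rfl | rfl) <;>
    · rw [mk_mem_hyperellipticPoints, homogenizedEval_curvePoly]
      norm_num

theorem mainTheorem1 :
    IsHyperellipticModel 3 (curvePoly 237) ∧
    hyperellipticPoints 3 (curvePoly 237) =
      {WeightedPlane.mk 3 1 4 1 (by simp), WeightedPlane.mk 3 1 (-4) 1 (by simp),
        WeightedPlane.mk 3 (-1) 4 1 (by simp), WeightedPlane.mk 3 (-1) (-4) 1 (by simp),
        WeightedPlane.mk 3 0 1 1 (by simp), WeightedPlane.mk 3 0 (-1) 1 (by simp),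
        WeightedPlane.mk 3 1 1 0 (by simp), WeightedPlane.mk 3 1 (-1) 0 (by simp)} ∧
    (hyperellipticPoints 3 (curvePoly 237)).ncard = 8 := by
  refine ⟨⟨by norm_num, curvePoly_monic, .inr curvePoly_natDegree, curvePoly_separable⟩,
    hyperellipticPoints_curvePoly, ?_⟩
  rw [hyperellipticPoints_curvePoly]
  -- For two listed points, equality of the outer coordinates either is impossible or forces t = 1,
  -- and then the ordinates differ.
  have ne : ∀ {x y z x' y' z' : ℚ} {h : (x, y, z) ≠ (0, 0, 0)} {h' : (x', y', z') ≠ (0, 0, 0)},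
      (∀ t : ℚ, x' = t * x → z' = t * z → t = 1 ∧ y ≠ y') →
      WeightedPlane.mk 3 x y z h ≠ WeightedPlane.mk 3 x' y' z' h' := by
    intro x y z x' y' z' h h' H e
    obtain ⟨t, -, h1, h2, h3⟩ := WeightedPlane.mk_eq_mk_iff.mp e
    obtain ⟨rfl, h4⟩ := H t h1 h3
    exact h4 (by rw [h2]; ring)
  repeat rw [Set.ncard_insert_of_notMem (by
    simp only [Set.mem_insert_iff, Set.mem_singleton_iff, not_or]
    repeat' apply And.intro
    all_goals
      refine ne fun t h1 h3 => ?_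
      first
      | exfalso; linarith
      | exact ⟨by linarith, by norm_num⟩)]
  rw [Set.ncard_singleton]
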